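/- Let $n\ge 0$. Let $\mathfrak g=\mathfrak{gl}_n(\mathbb C)$, let $B\subset GL_n(\mathbb C)$ be the group of invertible upper triangular matrices, $\mathfrak b$ the upper triangular and $\mathfrak u$ the strictly upper triangular matrices, and identify $\mathfrak b^*=\mathfrak g/\mathfrak u$ by the trace pairing; $\overline{v}$ denotes the class of $v\in\mathfrak g$ in $\mathfrak g/\mathfrak u$. Let $B$ act on $T^*(\mathfrak b\times\mathbb C^n)=\mathfrak b\times\mathfrak b^*\times\mathbb C^n\times(\mathbb C^n)^*$ by $b.(r,s,i,j)=(brb^{-1},\overline{bsb^{-1}},bi,jb^{-1})$, and let $\mu(r,s,i,j)=\overline{[r,s]+ij}\in\mathfrak b^*$. Let $\mu^{-1}(0)^{rss}$ be the set of all $(r,s,i,j)\in\mu^{-1}(0)$ such that $r$ has pairwise distinct eigenvalues, regarded as a scheme with coordinate ring $$\mathbb C[\mu^{-1}(0)^{rss}]=\mathbb C[T^*(\mathfrak b\times\mathbb C^n)]\big[(r_{\nu\nu}-r_{\gamma\gamma})^{-1}:\nu\ne\gamma\big]\big/\langle \mu(r,s,i,j)_{\iota\gamma}:\iota\ge\gamma\rangle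 .$$ Let $\mu^{-1}(0)^{rss}/\!\!/B=\operatorname{Spec}\mathbb C[\mu^{-1}(0)^{rss}]^B$ be the affine quotient. Put $l_k(r)=r-r_{kk}I$ and $$s'_{\iota\iota}=\Big[\operatorname{tr}\Big(\prod_{k\neq\iota}l_k(r)\Big)\Big]^{-1}\operatorname{tr}\Big(\prod_{k\neq\iota}l_k(r)\,s\Big)\qquad(1\le\iota\le n).$$ Let $\Delta_n\subset\mathbb C^{2n}$ be the set of all $(x_1,\dots,x_n,y_1,\dots,y_n)$ with $x_\iota=x_\gamma$ for some $\iota\ne\gamma$, and let $P:\mu^{-1}(0)^{rss}\to\mathbb C^{2n}\setminus\Delta_n$, $P(r,s,i,j)=(r_{11},\dots,r_{nn},s'_{11},\dots,s'_{nn})$. Theorem. (a) Every complex point of $\mu^{-1}(0)^{rss}/\!\!/B$ is the image of a point of $\mu^{-1}(0)^{rss}$, and two points $q,q'$ of $\mu^{-1}(0)^{rss}$ have the same image if and only if the orbit closures $\overline{B.q}$ and $\overline{B.q'}$ (in $\mu^{-1}(0)^{rss}$) meet. Moreover the map from $\mu^{-1}(0)^{rss}$ to the complex points of $\mu^{-1}(0)^{rss}/\!\!/B$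 is a topological quotient map. These statements hold both for the Zariski topology and for the classical topology. (b) $P$ descends to a bijection $p$ from the complex points of $\mu^{-1}(0)^{rss}/\!\!/B$ onto $\mathbb C^{2n}\setminus\Delta_n$, so that $p$ sends (the class of) $\overline{B.(r,s,i,j)}$ to $(r_{11},\dots,r_{nn},s'_{11},\dots,s'_{nn})$, and $p$ is a homeomorphism, both for the Zariski and for the classical topologies. (c) $p$ is an isomorphism of varieties. That is, there is an isomorphism of $\mathbb C$-algebras $$\mathbb C[x_1,\dots,x_n,y_1,\dots,y_n]\big[(x_\nu-x_\gamma)^{-1}:\nu\ne\gamma\big]\;\cong\;\mathbb C[\mu^{-1}(0)^{rss}]^B,\qquad x_\iota\mapsto r_{\iota\iota},\quad y_\iota\mapsto s'_{\iota\iota},$$ which is the comorphism of $p$; equivalently, there is an isomorphism of $\mathbb C$-schemes from $\mu^{-1}(0)^{rss}/\!\!/B$ onto the open subscheme $\mathbb C^{2n}\setminus\Delta_n$ of $\mathbb C^{2n}$ whose composition with the quotient morphism $\mu^{-1}(0)^{rss}\to\mu^{-1}(0)^{rss}/\!\!/B$ is $P$. -/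

import Mathlib

open Matrix

namespace BorelReduction

/-! ### The Borel subgroup and the cotangent bundle, over an arbitrary commutative ring -/

/-- The Borel subgroup `B` of invertible upper triangular matrices in `GL_n`. -/
def borel (n : ℕ) (S : Type*) [CommRing S] : Subgroup (GL (Fin n) S) where
  carrier := {b | (b : Matrix (Fin n) (Fin n) S).IsUpperTriangular}
  mul_mem' := fun {a b} ha hb => by
    have h : ((a : Matrix (Fin n) (Fin n) S) * (b : Matrix (Fin n) (Fin n) S)).BlockTriangular id :=
      Matrix.BlockTriangular.mul ha hb
    simpa using h
  one_mem' := by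
    have h : (1 : Matrix (Fin n) (Fin n) S).BlockTriangular id := Matrix.blockTriangular_one
    simpa using h
  inv_mem' := fun {a} ha => by
    have : Invertible (a : Matrix (Fin n) (Fin n) S) := Units.invertible a
    have h : ((a : Matrix (Fin n) (Fin n) S)⁻¹).BlockTriangular id :=
      Matrix.blockTriangular_inv_of_blockTriangular ha
    simpa using h

/-- The homomorphism `B(S) → B(T)` induced by a ring homomorphism `S → T`. -/
def borelMap {S T : Type*} [CommRing S] [CommRing T] (n : ℕ) (f : S →+* T) (b : borel n S) :
    borel n T :=
  ⟨Matrix.GeneralLinearGroup.map f b.1, fun α β h => by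
    have := b.2 h
    simp [this]⟩

/-- The projection `𝔤 → 𝔤/𝔲 = 𝔟^*`, where `𝔲` is the space of strictly upper triangular matrices.
A class in `𝔤/𝔲` is represented by its unique lower triangular representative, so that the
projection erases the entries strictly above the diagonal (see `lowerPart_eq_iff`). -/
def lowerPart {n : ℕ} {S : Type*} [CommRing S] (M : Matrix (Fin n) (Fin n) S) :
    Matrix (Fin n) (Fin n) S :=
  Matrix.of fun α β => if β ≤ α then M α β else 0

/-- The fibres of `lowerPart` are the cosets of the space `𝔲` of strictly upper triangular
matrices. -/
theorem lowerPart_eq_iff {n : ℕ} {S : Type*} [CommRing S] (M N : Matrix (Fin n) (Fin n) S) :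
    lowerPart M = lowerPart N ↔ ∀ α β, β ≤ α → (M - N) α β = 0 := by
  constructor
  · intro h α β hab
    have := congrFun (congrFun h α) β
    simp only [lowerPart, Matrix.of_apply, if_pos hab] at this
    simp [this]
  · intro h
    ext α β
    by_cases hab : β ≤ α
    · have := h α β hab
      simp only [lowerPart, Matrix.of_apply, if_pos hab]
      exact sub_eq_zero.mp (by simpa using this)
    · simp [lowerPart, hab]

theorem lowerPart_isLowerTriangular {n : ℕ} {S : Type*} [CommRing S]
    (M : Matrix (Fin n) (Fin n) S) : (lowerPart M).IsLowerTriangular := by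
  intro α β h
  have h' : α < β := h
  simp [lowerPart, not_le.mpr h']

theorem lowerPart_of_isLowerTriangular {n : ℕ} {S : Type*} [CommRing S]
    {M : Matrix (Fin n) (Fin n) S} (hM : M.IsLowerTriangular) : lowerPart M = M := by
  ext α β
  by_cases h : β ≤ α
  · simp [lowerPart, h]
  · have : M α β = 0 := hM (show α < β from not_le.mp h)
    simp [lowerPart, h, this]

/-- Left and right multiplication by upper triangular matrices preserves `𝔲`, hence descends to
`𝔤/𝔲`. -/
theorem lowerPart_mul_lowerPart_mul {n : ℕ} {S : Type*} [CommRing S]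
    {a c : Matrix (Fin n) (Fin n) S} (ha : a.IsUpperTriangular) (hc : c.IsUpperTriangular)
    (M : Matrix (Fin n) (Fin n) S) : lowerPart (a * lowerPart M * c) = lowerPart (a * M * c) := by
  ext α β
  by_cases h : β ≤ α
  · simp only [lowerPart, Matrix.of_apply, if_pos h, Matrix.mul_apply, Finset.sum_mul]
    refine Finset.sum_congr rfl fun l _ => Finset.sum_congr rfl fun k _ => ?_
    by_cases h1 : k < α
    · have : a α k = 0 := ha h1
      simp [this]
    by_cases h2 : β < l
    · have : c l β = 0 := hc h2
      simp [this]
    rw [if_pos (le_trans (not_lt.mp h2) (le_trans h (not_lt.mp h1)))]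
  · simp [lowerPart, h]

/-- The points `(r, s, i, j)` of `T^*(𝔟 × ℂ^n) = 𝔟 × 𝔟^* × ℂ^n × (ℂ^n)^*`
with values in a commutative ring `S`. -/
@[ext]
structure Cotangent (n : ℕ) (S : Type*) [CommRing S] where
  r : Matrix (Fin n) (Fin n) S
  s : Matrix (Fin n) (Fin n) S
  i : Fin n → S
  j : Fin n → S
  r_upper : r.IsUpperTriangular
  s_lower : s.IsLowerTriangular

/-- The action `b.(r, s, i, j) = (b r b⁻¹, \overline{b s b⁻¹}, b i, j b⁻¹)`. -/
instance (n : ℕ) (S : Type*) [CommRing S] : MulAction (borel n S) (Cotangent n S) where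
  smul b q :=
    { r := (b : GL (Fin n) S).1 * q.r * ((b⁻¹ : borel n S) : GL (Fin n) S).1
      s := lowerPart ((b : GL (Fin n) S).1 * q.s * ((b⁻¹ : borel n S) : GL (Fin n) S).1)
      i := (b : GL (Fin n) S).1 *ᵥ q.i
      j := q.j ᵥ* ((b⁻¹ : borel n S) : GL (Fin n) S).1
      r_upper := (Matrix.BlockTriangular.mul (Matrix.BlockTriangular.mul b.2 q.r_upper)
        (b⁻¹ : borel n S).2)
      s_lower := lowerPart_isLowerTriangular _ }
  one_smul q := by
    refine Cotangent.ext ?_ ?_ ?_ ?_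
    · change ((1 : borel n S) : GL (Fin n) S).1 * q.r * ((1⁻¹ : borel n S) : GL (Fin n) S).1 = q.r
      simp
    · change lowerPart (((1 : borel n S) : GL (Fin n) S).1 * q.s *
        ((1⁻¹ : borel n S) : GL (Fin n) S).1) = q.s
      simpa using lowerPart_of_isLowerTriangular q.s_lower
    · change ((1 : borel n S) : GL (Fin n) S).1 *ᵥ q.i = q.i
      simp
    · change q.j ᵥ* ((1⁻¹ : borel n S) : GL (Fin n) S).1 = q.j
      simp
  mul_smul a b q := by
    refine Cotangent.ext ?_ ?_ ?_ ?_
    · change ((a * b : borel n S) : GL (Fin n) S).1 * q.r *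
          (((a * b)⁻¹ : borel n S) : GL (Fin n) S).1 =
        (a : GL (Fin n) S).1 * ((b : GL (Fin n) S).1 * q.r * ((b⁻¹ : borel n S) : GL (Fin n) S).1)
          * ((a⁻¹ : borel n S) : GL (Fin n) S).1
      rw [_root_.mul_inv_rev]
      simp only [Subgroup.coe_mul, Units.val_mul, Matrix.mul_assoc]
    · change lowerPart (((a * b : borel n S) : GL (Fin n) S).1 * q.s *
          (((a * b)⁻¹ : borel n S) : GL (Fin n) S).1) =
        lowerPart ((a : GL (Fin n) S).1 * lowerPart ((b : GL (Fin n) S).1 * q.s *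
          ((b⁻¹ : borel n S) : GL (Fin n) S).1) * ((a⁻¹ : borel n S) : GL (Fin n) S).1)
      rw [lowerPart_mul_lowerPart_mul a.2 (a⁻¹ : borel n S).2, _root_.mul_inv_rev]
      simp only [Subgroup.coe_mul, Units.val_mul, Matrix.mul_assoc]
    · change ((a * b : borel n S) : GL (Fin n) S).1 *ᵥ q.i =
        (a : GL (Fin n) S).1 *ᵥ ((b : GL (Fin n) S).1 *ᵥ q.i)
      simp [Matrix.mulVec_mulVec]
    · change q.j ᵥ* (((a * b)⁻¹ : borel n S) : GL (Fin n) S).1 =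
        (q.j ᵥ* ((b⁻¹ : borel n S) : GL (Fin n) S).1) ᵥ* ((a⁻¹ : borel n S) : GL (Fin n) S).1
      rw [_root_.mul_inv_rev, Matrix.vecMul_vecMul]
      simp only [Subgroup.coe_mul, Units.val_mul]

/-- The moment map `μ(r, s, i, j) = \overline{[r, s] + i j}` with values in `𝔟^* = 𝔤/𝔲`. -/
def moment {n : ℕ} {S : Type*} [CommRing S] (q : Cotangent n S) : Matrix (Fin n) (Fin n) S :=
  lowerPart (q.r * q.s - q.s * q.r + Matrix.vecMulVec q.i q.j)

/-- The moment map is `B`-equivariant. -/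
theorem moment_smul {n : ℕ} {S : Type*} [CommRing S] (b : borel n S) (q : Cotangent n S) :
    moment (b • q) = lowerPart ((b : GL (Fin n) S).1 * moment q *
      ((b⁻¹ : borel n S) : GL (Fin n) S).1) := by
  have hb : ((b⁻¹ : borel n S) : GL (Fin n) S).1 * (b : GL (Fin n) S).1 = 1 := by
    rw [← Units.val_mul, ← Subgroup.coe_mul]; simp
  set B := (b : GL (Fin n) S).1 with hB
  set C := ((b⁻¹ : borel n S) : GL (Fin n) S).1 with hC
  have hBu : B.IsUpperTriangular := b.2
  have hCu : C.IsUpperTriangular := (b⁻¹ : borel n S).2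
  have hru : (B * q.r * C).IsUpperTriangular :=
    Matrix.BlockTriangular.mul (Matrix.BlockTriangular.mul hBu q.r_upper) hCu
  have h1 : ((1 : Matrix (Fin n) (Fin n) S)).IsUpperTriangular := Matrix.blockTriangular_one
  have add : ∀ M N : Matrix (Fin n) (Fin n) S, lowerPart (M + N) = lowerPart M + lowerPart N := by
    intro M N; ext α β; by_cases h : β ≤ α <;> simp [lowerPart, h]
  have sub : ∀ M N : Matrix (Fin n) (Fin n) S, lowerPart (M - N) = lowerPart M - lowerPart N := by
    intro M N; ext α β; by_cases h : β ≤ α <;> simp [lowerPart, h]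
  have e1 : lowerPart ((B * q.r * C) * lowerPart (B * q.s * C)) =
      lowerPart ((B * q.r * C) * (B * q.s * C)) := by
    simpa using lowerPart_mul_lowerPart_mul hru h1 (B * q.s * C)
  have e2 : lowerPart (lowerPart (B * q.s * C) * (B * q.r * C)) =
      lowerPart ((B * q.s * C) * (B * q.r * C)) := by
    simpa using lowerPart_mul_lowerPart_mul h1 hru (B * q.s * C)
  change lowerPart ((B * q.r * C) * lowerPart (B * q.s * C) - lowerPart (B * q.s * C) *
    (B * q.r * C) + Matrix.vecMulVec (B *ᵥ q.i) (q.j ᵥ* C)) = lowerPart (B * lowerPart _ * C)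
  rw [lowerPart_mul_lowerPart_mul hBu hCu, add, sub, e1, e2, ← sub, ← add]
  congr 1
  rw [Matrix.mul_add, Matrix.mul_sub, Matrix.add_mul, Matrix.sub_mul, Matrix.mul_vecMulVec,
    Matrix.vecMulVec_mul]
  have k : ∀ M N : Matrix (Fin n) (Fin n) S, B * M * C * (B * N * C) = B * (M * N) * C := by
    intro M N
    calc B * M * C * (B * N * C) = B * M * (C * B) * N * C := by simp only [Matrix.mul_assoc]
      _ = B * (M * N) * C := by rw [hb]; simp only [Matrix.mul_one, Matrix.mul_assoc]
  rw [k, k]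

/-- The diagonal of an upper triangular matrix is invariant under conjugation by `B`. -/
theorem smul_r_diag {n : ℕ} {S : Type*} [CommRing S] (b : borel n S) (q : Cotangent n S)
    (α : Fin n) : (b • q).r α α = q.r α α := by
  have hb : (b : GL (Fin n) S).1 * ((b⁻¹ : borel n S) : GL (Fin n) S).1 = 1 := by
    rw [← Units.val_mul, ← Subgroup.coe_mul]; simp
  have diag : ∀ M N : Matrix (Fin n) (Fin n) S, M.IsUpperTriangular → N.IsUpperTriangular →
      (M * N) α α = M α α * N α α := by
    intro M N hM hN
    rw [Matrix.mul_apply]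
    refine Finset.sum_eq_single α (fun k _ hk => ?_) (by simp)
    rcases lt_or_gt_of_ne hk with h | h
    · have : M α k = 0 := hM h
      simp [this]
    · have : N k α = 0 := hN h
      simp [this]
  change ((b : GL (Fin n) S).1 * q.r * ((b⁻¹ : borel n S) : GL (Fin n) S).1) α α = q.r α α
  rw [diag _ _ (Matrix.BlockTriangular.mul b.2 q.r_upper) (b⁻¹ : borel n S).2,
    diag _ _ b.2 q.r_upper]
  have h := diag _ _ b.2 (b⁻¹ : borel n S).2
  rw [hb, Matrix.one_apply_eq] at h
  linear_combination -(q.r α α) * h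

/-- The points of `μ⁻¹(0)^{rss}` with values in `S`: the quadruples with `μ(r, s, i, j) = 0` such
that the differences of the diagonal entries of `r` are invertible. Over `ℂ` the latter says that
`r` has `n` distinct eigenvalues, see `isUnit_sub_iff_distinct_eigenvalues`. -/
def MuZeroRss (n : ℕ) (S : Type*) [CommRing S] : Type _ :=
  {q : Cotangent n S // moment q = 0 ∧ ∀ α β, α ≠ β → IsUnit (q.r α α - q.r β β)}

/-- Over `ℂ`, the condition on the diagonal of `r` in `MuZeroRss` says that the eigenvalues of `r`
(the roots of its characteristic polynomial) are pairwise distinct. -/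
theorem isUnit_sub_iff_distinct_eigenvalues {n : ℕ} (q : Cotangent n ℂ) :
    (∀ α β, α ≠ β → IsUnit (q.r α α - q.r β β)) ↔ q.r.charpoly.roots.Nodup := by
  have h : q.r.charpoly.roots = (Finset.univ : Finset (Fin n)).val.map fun α => q.r α α := by
    rw [Matrix.charpoly_of_isUpperTriangular _ q.r_upper]
    have e := Polynomial.roots_multiset_prod_X_sub_C
      ((Finset.univ : Finset (Fin n)).val.map fun α => q.r α α)
    rw [Multiset.map_map] at e
    exact e
  rw [h, Multiset.nodup_map_iff_inj_on Finset.univ.nodup]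
  simp only [isUnit_iff_ne_zero, sub_ne_zero]
  constructor
  · intro H α _ β _ hab
    by_contra hne
    exact H α β hne hab
  · intro H α β hne hab
    exact hne (H α (Finset.mem_univ α) β (Finset.mem_univ β) hab)

/-- `B` acts on `μ⁻¹(0)^{rss}`. -/
instance (n : ℕ) (S : Type*) [CommRing S] : MulAction (borel n S) (MuZeroRss n S) where
  smul b q := ⟨b • q.1, by
    rw [moment_smul, q.2.1]
    ext α β
    simp [lowerPart], fun α β h => by
    rw [smul_r_diag, smul_r_diag]
    exact q.2.2 α β h⟩
  one_smul q := Subtype.ext (one_smul _ q.1)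
  mul_smul a b q := Subtype.ext (mul_smul a b q.1)

/-- The ordered product `∏_{k ≠ α} l_k(r)`, where `l_k(r) = r - r_{kk} I`. -/
def lProd {n : ℕ} {S : Type*} [CommRing S] (r : Matrix (Fin n) (Fin n) S) (α : Fin n) :
    Matrix (Fin n) (Fin n) S :=
  (((List.finRange n).filter fun k => k ≠ α).map fun k => r - Matrix.scalar (Fin n) (r k k)).prod

/-- The function `s'_{αα} = [tr (∏_{k ≠ α} l_k(r))]⁻¹ tr (∏_{k ≠ α} l_k(r) s)`. On
`μ⁻¹(0)^{rss}` the first trace equals `∏_{k ≠ α} (r_{αα} - r_{kk})`, which is invertible. -/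
noncomputable def sPrime {n : ℕ} {S : Type*} [CommRing S] (q : Cotangent n S) (α : Fin n) : S :=
  Ring.inverse (lProd q.r α).trace * (lProd q.r α * q.s).trace

/-! ### The map on complex points -/

/-- The set `Δ_n ⊆ ℂ^{2n}` of all `(x_1, …, x_n, y_1, …, y_n)` with `x_α = x_β` for some
`α ≠ β`; the coordinate `x_α` has index `Sum.inl α`, and `y_α` has index `Sum.inr α`. -/
def Delta (n : ℕ) : Set (Fin n ⊕ Fin n → ℂ) :=
  {z | ∃ α β : Fin n, α ≠ β ∧ z (Sum.inl α) = z (Sum.inl β)}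

/-- The map `P : μ⁻¹(0)^{rss} → ℂ^{2n} ∖ Δ_n`. -/
noncomputable def P {n : ℕ} (q : MuZeroRss n ℂ) : ((Delta n)ᶜ : Set (Fin n ⊕ Fin n → ℂ)) :=
  ⟨Sum.elim (fun α => q.1.r α α) (sPrime q.1), by
    rintro ⟨α, β, hne, h⟩
    have := (q.2.2 α β hne).ne_zero
    simp only [Sum.elim_inl] at h
    exact this (sub_eq_zero.mpr h)⟩

/-! ### The coordinate ring of `μ⁻¹(0)^{rss}` and its `B`-invariants -/

/-- The coordinates `r_{αβ}` (`α ≤ β`), `s_{αβ}` (`β ≤ α`), `x_k`, `y_l` of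
`T^*(𝔟 × ℂ^n)`, where `i = (x_k)` and `j = (y_l)`. -/
inductive Coord (n : ℕ) : Type
  | r (α β : Fin n) (h : α ≤ β) : Coord n
  | s (α β : Fin n) (h : β ≤ α) : Coord n
  | x (k : Fin n) : Coord n
  | y (l : Fin n) : Coord n

/-- The value of a coordinate at a point. -/
def Coord.eval {n : ℕ} {S : Type*} [CommRing S] (q : Cotangent n S) : Coord n → S
  | .r α β _ => q.r α β
  | .s α β _ => q.s α β
  | .x k => q.i k
  | .y l => q.j l

/-- The coordinate ring `ℂ[T^*(𝔟 × ℂ^n)]`. -/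
abbrev CotangentRing (n : ℕ) : Type := MvPolynomial (Coord n) ℂ

/-- The image of a quadruple under a ring homomorphism. -/
def Cotangent.map {n : ℕ} {S T : Type*} [CommRing S] [CommRing T] (f : S →+* T)
    (q : Cotangent n S) : Cotangent n T where
  r := q.r.map f
  s := q.s.map f
  i := f ∘ q.i
  j := f ∘ q.j
  r_upper := fun α β h => by
    have := q.r_upper h
    simp [this]
  s_lower := fun α β h => by
    have := q.s_lower h
    simp [this]

/-- The tautological point of `T^*(𝔟 × ℂ^n)`, whose entries are the coordinate functions. -/
noncomputable def tautological (n : ℕ) : Cotangent n (CotangentRing n) where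
  r := Matrix.of fun α β => if h : α ≤ β then MvPolynomial.X (Coord.r α β h) else 0
  s := Matrix.of fun α β => if h : β ≤ α then MvPolynomial.X (Coord.s α β h) else 0
  i := fun k => MvPolynomial.X (Coord.x k)
  j := fun l => MvPolynomial.X (Coord.y l)
  r_upper := fun α β h => by
    have h' : β < α := h
    simp [not_le.mpr h']
  s_lower := fun α β h => by
    have h' : α < β := h
    simp [not_le.mpr h']

/-- The product `∏_{α < β} (x_β - x_α)`. -/
def disc {n : ℕ} {S : Type*} [CommRing S] (x : Fin n → S) : S :=
  ∏ α : Fin n, ∏ β ∈ Finset.Ioi α, (x β - x α)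

theorem isUnit_disc_iff {n : ℕ} {S : Type*} [CommRing S] (x : Fin n → S) :
    IsUnit (disc x) ↔ ∀ α β, α ≠ β → IsUnit (x α - x β) := by
  simp only [disc, IsUnit.prod_iff, Finset.mem_univ, Finset.mem_Ioi, true_imp_iff]
  constructor
  · intro H α β hne
    rcases lt_or_gt_of_ne hne with h | h
    · rw [← neg_sub]
      exact (H α β h).neg
    · exact H β α h
  · intro H α β h
    exact H β α h.ne'

theorem map_disc {n : ℕ} {S T : Type*} [CommRing S] [CommRing T] (f : S →+* T) (x : Fin n → S) :
    f (disc x) = disc fun α => f (x α) := by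
  simp [disc, map_prod]

theorem map_moment {n : ℕ} {S T : Type*} [CommRing S] [CommRing T] (f : S →+* T)
    (q : Cotangent n S) : moment (q.map f) = (moment q).map f := by
  ext α β
  by_cases h : β ≤ α
  · simp [moment, lowerPart, h, Cotangent.map, Matrix.mul_apply, Matrix.vecMulVec_apply]
  · simp [moment, lowerPart, h]

/-- The coordinate ring `ℂ[T^*(𝔟 × ℂ^n)^{rss}]`: the differences `r_{ββ} - r_{αα}` are
inverted. -/
abbrev CotangentRssRing (n : ℕ) : Type :=
  Localization.Away (disc fun α => (tautological n).r α α)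

/-- The ideal of `ℂ[T^*(𝔟 × ℂ^n)^{rss}]` generated by the entries of the moment map. -/
noncomputable def momentIdeal (n : ℕ) : Ideal (CotangentRssRing n) :=
  Ideal.span (Set.range fun p : Fin n × Fin n =>
    moment ((tautological n).map (algebraMap (CotangentRing n) (CotangentRssRing n))) p.1 p.2)

/-- The coordinate ring `ℂ[μ⁻¹(0)^{rss}]`. -/
abbrev CoordRing (n : ℕ) : Type := CotangentRssRing n ⧸ momentIdeal n

/-- The natural map `ℂ[T^*(𝔟 × ℂ^n)] → ℂ[μ⁻¹(0)^{rss}]`. -/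
noncomputable def toCoordRing (n : ℕ) : CotangentRing n →+* CoordRing n :=
  (Ideal.Quotient.mk (momentIdeal n)).comp (algebraMap (CotangentRing n) (CotangentRssRing n))

/-- The tautological point of `μ⁻¹(0)^{rss}` with values in its coordinate ring. -/
noncomputable def universalPoint (n : ℕ) : MuZeroRss n (CoordRing n) :=
  ⟨(tautological n).map (toCoordRing n), by
    ext α β
    have e : (tautological n).map (toCoordRing n) =
        ((tautological n).map (algebraMap (CotangentRing n) (CotangentRssRing n))).map
          (Ideal.Quotient.mk (momentIdeal n)) := rfl
    rw [e, map_moment, Matrix.map_apply, Matrix.zero_apply, Ideal.Quotient.eq_zero_iff_mem]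
    exact Ideal.subset_span ⟨(α, β), rfl⟩, by
    refine (isUnit_disc_iff fun α => ((tautological n).map (toCoordRing n)).r α α).mp ?_
    have h : IsUnit (algebraMap (CotangentRing n) (CotangentRssRing n)
        (disc fun α => (tautological n).r α α)) :=
      IsLocalization.Away.algebraMap_isUnit _
    have h' := h.map (Ideal.Quotient.mk (momentIdeal n))
    have e := map_disc (toCoordRing n) fun α => (tautological n).r α α
    exact e ▸ h'⟩

theorem map_aeval_tautological {n : ℕ} {S : Type*} [CommRing S] [Algebra ℂ S]
    (q : Cotangent n S) :
    (tautological n).map (MvPolynomial.aeval (Coord.eval q) : CotangentRing n →ₐ[ℂ] S).toRingHom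
      = q := by
  refine Cotangent.ext ?_ ?_ ?_ ?_
  · ext α β
    by_cases h : α ≤ β
    · simp [Cotangent.map, tautological, h, Coord.eval]
    · have : q.r α β = 0 := q.r_upper (show β < α from not_le.mp h)
      simp [Cotangent.map, tautological, h, this]
  · ext α β
    by_cases h : β ≤ α
    · simp [Cotangent.map, tautological, h, Coord.eval]
    · have : q.s α β = 0 := q.s_lower (show α < β from not_le.mp h)
      simp [Cotangent.map, tautological, h, this]
  · ext k
    simp [Cotangent.map, tautological, Coord.eval]
  · ext k
    simp [Cotangent.map, tautological, Coord.eval]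

theorem isUnit_aeval_disc {n : ℕ} {S : Type*} [CommRing S] [Algebra ℂ S] (q : MuZeroRss n S) :
    IsUnit ((MvPolynomial.aeval (Coord.eval q.1) : CotangentRing n →ₐ[ℂ] S)
      (disc fun α => (tautological n).r α α)) := by
  have e := map_disc (MvPolynomial.aeval (Coord.eval q.1) : CotangentRing n →ₐ[ℂ] S).toRingHom
    fun α => (tautological n).r α α
  have h2 : (fun α => (MvPolynomial.aeval (Coord.eval q.1) : CotangentRing n →ₐ[ℂ] S).toRingHom
      ((tautological n).r α α)) = fun α => q.1.r α α := by
    funext α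
    exact congrFun (congrFun (congrArg Cotangent.r (map_aeval_tautological q.1)) α) α
  rw [h2] at e
  exact e ▸ (isUnit_disc_iff _).mpr q.2.2

/-- Evaluation at an `S`-valued point of `μ⁻¹(0)^{rss}`: the homomorphism `ℂ[μ⁻¹(0)^{rss}] → S`
that sends every coordinate function to its value at the point. -/
noncomputable def evalAt {n : ℕ} {S : Type*} [CommRing S] [Algebra ℂ S] (q : MuZeroRss n S) :
    CoordRing n →ₐ[ℂ] S :=
  Ideal.Quotient.liftₐ (momentIdeal n)
    (IsLocalization.Away.liftAlgHom (disc fun α => (tautological n).r α α)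
      (S := CotangentRssRing n) (isUnit_aeval_disc q))
    (by
      intro a ha
      have hle : momentIdeal n ≤ RingHom.ker
          (IsLocalization.Away.liftAlgHom (disc fun α => (tautological n).r α α)
            (S := CotangentRssRing n) (isUnit_aeval_disc q)).toRingHom := by
        refine Ideal.span_le.mpr ?_
        rintro _ ⟨⟨α, β⟩, rfl⟩
        have e : ((tautological n).map (algebraMap (CotangentRing n) (CotangentRssRing n))).map
            (IsLocalization.Away.liftAlgHom (disc fun α => (tautological n).r α α)
              (S := CotangentRssRing n) (isUnit_aeval_disc q)).toRingHom = q.1 := by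
          refine Eq.trans ?_ (map_aeval_tautological q.1)
          refine Cotangent.ext ?_ ?_ ?_ ?_
          · ext α β
            exact IsLocalization.Away.lift_eq _ (isUnit_aeval_disc q) _
          · ext α β
            exact IsLocalization.Away.lift_eq _ (isUnit_aeval_disc q) _
          · ext α
            exact IsLocalization.Away.lift_eq _ (isUnit_aeval_disc q) _
          · ext α
            exact IsLocalization.Away.lift_eq _ (isUnit_aeval_disc q) _
        have m := map_moment (IsLocalization.Away.liftAlgHom
          (disc fun α => (tautological n).r α α) (S := CotangentRssRing n)
          (isUnit_aeval_disc q)).toRingHom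
          ((tautological n).map (algebraMap (CotangentRing n) (CotangentRssRing n)))
        rw [e, q.2.1] at m
        exact (congrFun (congrFun m α) β).symm
      exact hle ha)

/-- The automorphism `f ↦ (q ↦ f (b.q))` of `ℂ[μ⁻¹(0)^{rss}]` given by `b ∈ B`. -/
noncomputable def translate {n : ℕ} (b : borel n ℂ) : CoordRing n →ₐ[ℂ] CoordRing n :=
  evalAt (borelMap n (algebraMap ℂ (CoordRing n)) b • universalPoint n)

/-- The ring `ℂ[μ⁻¹(0)^{rss}]^B` of `B`-invariant functions. -/
noncomputable def invariantRing (n : ℕ) : Subalgebra ℂ (CoordRing n) :=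
  ⨅ b : borel n ℂ, AlgHom.equalizer (translate b) (AlgHom.id ℂ (CoordRing n))

/-! ### The affine quotient, its complex points, and topologies -/

/-- The complex points of the affine quotient `μ⁻¹(0)^{rss} // B = Spec ℂ[μ⁻¹(0)^{rss}]^B`. -/
abbrev QuotientPoints (n : ℕ) : Type := invariantRing n →ₐ[ℂ] ℂ

/-- The map from `μ⁻¹(0)^{rss}` to its affine quotient, on complex points. -/
noncomputable def quotientPoint {n : ℕ} (q : MuZeroRss n ℂ) : QuotientPoints n :=
  (evalAt q).comp (invariantRing n).val

/-- The Zariski topology on a set `Y` of complex points of `Spec A`: it is induced from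
`Spec A` by sending a point to the kernel of the evaluation at this point. -/
@[reducible] def zariski {Y A : Type*} [CommRing A] [Algebra ℂ A] (ev : Y → (A →ₐ[ℂ] ℂ)) :
    TopologicalSpace Y :=
  TopologicalSpace.induced
    (fun y => (⟨RingHom.ker (ev y), RingHom.ker_isPrime _⟩ : PrimeSpectrum A)) inferInstance

/-- The Zariski topology on `μ⁻¹(0)^{rss}`. -/
@[reducible] noncomputable def zariskiRss (n : ℕ) : TopologicalSpace (MuZeroRss n ℂ) := zariski evalAt

/-- The Zariski topology on the complex points of the affine quotient. -/
@[reducible] noncomputable def zariskiQuotient (n : ℕ) : TopologicalSpace (QuotientPoints n) := zariski id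

/-- The Zariski topology on `ℂ^{2n} ∖ Δ_n`, as a subspace of `ℂ^{2n}`. -/
@[reducible] noncomputable def zariskiTarget (n : ℕ) :
    TopologicalSpace ((Delta n)ᶜ : Set (Fin n ⊕ Fin n → ℂ)) :=
  zariski (A := MvPolynomial (Fin n ⊕ Fin n) ℂ) fun z => MvPolynomial.aeval z.1

/-- The classical topology on `μ⁻¹(0)^{rss}`, as a subspace of a complex vector space. -/
@[reducible] noncomputable def classicalRss (n : ℕ) : TopologicalSpace (MuZeroRss n ℂ) :=
  TopologicalSpace.induced (fun q => (q.1.r, q.1.s, q.1.i, q.1.j)) inferInstance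

/-- The classical topology on the complex points of the affine quotient: the coarsest one for
which all regular functions are continuous. -/
@[reducible] noncomputable def classicalQuotient (n : ℕ) : TopologicalSpace (QuotientPoints n) :=
  TopologicalSpace.induced (fun z => (z : invariantRing n → ℂ)) inferInstance

/-- The closure of the orbit `B.q` in `μ⁻¹(0)^{rss}` for a given topology. -/
def orbitClosure {n : ℕ} (t : TopologicalSpace (MuZeroRss n ℂ)) (q : MuZeroRss n ℂ) :
    Set (MuZeroRss n ℂ) :=
  @closure _ t (MulAction.orbit (borel n ℂ) q)

/-! ### The schemes -/

open AlgebraicGeometry CategoryTheory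

/-- The polynomial `∏_{α < β} (x_β - x_α)` in the coordinate ring `ℂ[x_α, y_α]` of `ℂ^{2n}`. -/
noncomputable def discPoly (n : ℕ) : MvPolynomial (Fin n ⊕ Fin n) ℂ :=
  disc fun α => MvPolynomial.X (Sum.inl α)

/-- The comorphism `ℂ[x_α, y_α] → ℂ[μ⁻¹(0)^{rss}]` of `P`, with `x_α ↦ r_{αα}` and
`y_α ↦ s'_{αα}`. -/
noncomputable def comorphismP (n : ℕ) :
    MvPolynomial (Fin n ⊕ Fin n) ℂ →ₐ[ℂ] CoordRing n :=
  MvPolynomial.aeval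
    (Sum.elim (fun α => (universalPoint n).1.r α α) (sPrime (universalPoint n).1))

/-- The affine quotient `μ⁻¹(0)^{rss} // B = Spec ℂ[μ⁻¹(0)^{rss}]^B`. -/
noncomputable def affineQuotient (n : ℕ) : Scheme := Spec (CommRingCat.of (invariantRing n))

/-- The quotient morphism `μ⁻¹(0)^{rss} → μ⁻¹(0)^{rss} // B`. -/
noncomputable def quotientMorphism (n : ℕ) :
    Spec (CommRingCat.of (CoordRing n)) ⟶ affineQuotient n :=
  Spec.map (CommRingCat.ofHom (invariantRing n).val.toRingHom)

/-- The open subscheme `ℂ^{2n} ∖ Δ_n` of `ℂ^{2n} = Spec ℂ[x_α, y_α]`. -/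
noncomputable def targetOpen (n : ℕ) :
    (Spec (CommRingCat.of (MvPolynomial (Fin n ⊕ Fin n) ℂ))).Opens :=
  PrimeSpectrum.basicOpen (discPoly n)

end BorelReduction

/-!
The theorem is proved by computing with points of `μ⁻¹(0)^{rss}` valued in arbitrary `ℂ`-algebras,
so that reducedness of the coordinate ring is not needed.

Let `q = (r, s, i, j)` be such a point. By Cayley–Hamilton the rows of `∏_{k ≠ α} l_k(r)` are left
eigenvectors of `r`, and after normalization they form a unitriangular matrix that conjugates `r` to
its diagonal part (`exists_unipotent_smul_eq_slice`). For diagonal `r = diag x` the equation `μ = 0`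
determines the off-diagonal part of `s` from `x, i, j`, leaves the diagonal `y` of `s` free, and
says that `i_α j_α = 0` for all `α` (`eq_slice_of_r_eq_diagonal`). There `s'_{αα} = y_α`, and since
`s'` is `B`-invariant, `y = s'(q)` in general (`sPrime_smul`, `sPrime_slice`).

An invariant function `f` takes the same value at `q` and at `(diag x, diag y, 0, 0)`
(`evalAt_eq_evalAt_diagPoint`). For the passage to the slice, invariance under the complex points of
`B` gives invariance under unitriangular matrices with entries in any algebra, because the complex
points of an affine space are dense (`evalAt_unipotent_smul`). On the slice, `f` is a polynomial in
`i` and `j` modulo the monomials `i_α j_α` that is invariant under the torus, and each monomial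
other than `1` that is not divisible by some `i_α j_α` has nonzero weight (`sub_C_mem_crossIdeal`,
`evalAt_slice`).

Applied to the universal point this shows that the comorphism of `P` and the restriction to the
points `(diag x, diag y, 0, 0)` are inverse isomorphisms between the coordinate ring of
`ℂ^{2n} ∖ Δ_n` and the ring of invariants (`invariantEquiv`). The statements on schemes and on the
bijection `p` follow. The regular, hence continuous, section `(x, y) ↦ (diag x, diag y, 0, 0)` of
`P` makes `p` a homeomorphism and the quotient map a topological quotient map. A one-parameter
subgroup of the torus contracts a complex point of the slice to `(diag x, diag y, 0, 0)`
(`sectionP_mem_orbitClosure`), so this point lies in the closures of all orbits with the same image.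
-/

namespace BorelReduction

/-! ### Functoriality of points -/

theorem mul_diag_of_isUpperTriangular {n : ℕ} {S : Type*} [CommRing S]
    {M N : Matrix (Fin n) (Fin n) S} (hM : M.IsUpperTriangular) (hN : N.IsUpperTriangular)
    (α : Fin n) : (M * N) α α = M α α * N α α := by
  rw [Matrix.mul_apply]
  refine Finset.sum_eq_single α (fun k _ hk => ?_) (by simp)
  rcases lt_or_gt_of_ne hk with h | h
  · have : M α k = 0 := hM h
    simp [this]
  · have : N k α = 0 := hN h
    simp [this]

section Points

variable {n : ℕ} {S T : Type*} [CommRing S] [CommRing T]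

theorem smul_r (b : borel n S) (q : Cotangent n S) :
    (b • q).r = b.1.1 * q.r * (b⁻¹ : borel n S).1.1 := rfl

theorem smul_s (b : borel n S) (q : Cotangent n S) :
    (b • q).s = lowerPart (b.1.1 * q.s * (b⁻¹ : borel n S).1.1) := rfl

theorem borel_mul_inv (b : borel n S) : b.1.1 * (b⁻¹ : borel n S).1.1 = 1 := by
  rw [← Units.val_mul, ← Subgroup.coe_mul]; simp

theorem borel_inv_mul (b : borel n S) : (b⁻¹ : borel n S).1.1 * b.1.1 = 1 := by
  rw [← Units.val_mul, ← Subgroup.coe_mul]; simp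

theorem coe_borelMap (f : S →+* T) (b : borel n S) : (borelMap n f b).1.1 = b.1.1.map f := rfl

theorem coe_borelMap_inv (f : S →+* T) (b : borel n S) :
    ((borelMap n f b)⁻¹ : borel n T).1.1 = (b⁻¹ : borel n S).1.1.map f := by
  have h : (borelMap n f b).1.1 * (b⁻¹ : borel n S).1.1.map f = 1 := by
    rw [coe_borelMap, ← Matrix.map_mul, borel_mul_inv]
    simp
  calc ((borelMap n f b)⁻¹ : borel n T).1.1
      = ((borelMap n f b)⁻¹ : borel n T).1.1 *
        ((borelMap n f b).1.1 * (b⁻¹ : borel n S).1.1.map f) := by rw [h, Matrix.mul_one]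
    _ = _ := by rw [← Matrix.mul_assoc, borel_inv_mul, Matrix.one_mul]

theorem map_lowerPart (f : S →+* T) (M : Matrix (Fin n) (Fin n) S) :
    (lowerPart M).map f = lowerPart (M.map f) := by
  ext α β
  by_cases h : β ≤ α <;> simp [lowerPart, h]

theorem Cotangent.map_smul (f : S →+* T) (b : borel n S) (q : Cotangent n S) :
    (b • q).map f = borelMap n f b • q.map f := by
  refine Cotangent.ext ?_ ?_ ?_ ?_
  · change (b • q).r.map f = _ * q.r.map f * _
    rw [smul_r, Matrix.map_mul, Matrix.map_mul, coe_borelMap_inv]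
    rfl
  · change (b • q).s.map f = lowerPart (_ * q.s.map f * _)
    rw [smul_s, map_lowerPart, Matrix.map_mul, Matrix.map_mul, coe_borelMap_inv]
    rfl
  · change f ∘ (b.1.1 *ᵥ q.i) = b.1.1.map f *ᵥ (f ∘ q.i)
    funext α
    simp [Matrix.mulVec, dotProduct]
  · change f ∘ (q.j ᵥ* (b⁻¹ : borel n S).1.1) = (f ∘ q.j) ᵥ* ((borelMap n f b)⁻¹ : borel n T).1.1
    rw [coe_borelMap_inv]
    funext α
    simp [Matrix.vecMul, dotProduct]

/-- The image of an `S`-valued point of `μ⁻¹(0)^{rss}` under a ring homomorphism `S → T`. -/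
def MuZeroRss.map (f : S →+* T) (q : MuZeroRss n S) : MuZeroRss n T :=
  ⟨q.1.map f, by
    rw [map_moment, q.2.1]
    ext
    simp, fun α β h => by
    have := (q.2.2 α β h).map f
    rwa [map_sub] at this⟩

theorem MuZeroRss.map_smul (f : S →+* T) (b : borel n S) (q : MuZeroRss n S) :
    (b • q).map f = borelMap n f b • q.map f :=
  Subtype.ext (Cotangent.map_smul f b q.1)

/-- An upper triangular matrix with invertible diagonal entries, as an element of `B`. -/
noncomputable def borelMk (M : Matrix (Fin n) (Fin n) S) (hM : M.IsUpperTriangular)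
    (hd : ∀ α, IsUnit (M α α)) : borel n S :=
  ⟨Matrix.GeneralLinearGroup.mk'' M (by
    rw [Matrix.det_of_isUpperTriangular hM]
    exact IsUnit.prod_univ_iff.mpr hd), hM⟩

theorem coe_borelMk (M : Matrix (Fin n) (Fin n) S) (hM : M.IsUpperTriangular)
    (hd : ∀ α, IsUnit (M α α)) : (borelMk M hM hd).1.1 = M := rfl

theorem borel_ext {b c : borel n S} (h : b.1.1 = c.1.1) : b = c :=
  Subtype.ext (Units.ext h)

end Points

/-! ### Evaluation of functions at points -/

section Eval

variable {n : ℕ} {S T : Type*} [CommRing S] [CommRing T] [Algebra ℂ S] [Algebra ℂ T]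

theorem evalAt_toCoordRing (q : MuZeroRss n S) (a : CotangentRing n) :
    evalAt q (toCoordRing n a) = MvPolynomial.aeval (Coord.eval q.1) a :=
  IsLocalization.Away.lift_eq _ (isUnit_aeval_disc q) a

theorem coordRing_algHom_ext {f g : CoordRing n →ₐ[ℂ] S}
    (h : ∀ c, f (toCoordRing n (MvPolynomial.X c)) = g (toCoordRing n (MvPolynomial.X c))) :
    f = g := by
  refine Ideal.Quotient.algHom_ext ℂ ?_
  refine IsLocalization.algHom_ext (Submonoid.powers (disc fun α => (tautological n).r α α)) ?_
  refine MvPolynomial.algHom_ext ?_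
  exact h

/-- `S`-valued points of `μ⁻¹(0)^{rss}` are the images of the universal point under homomorphisms
from the coordinate ring to `S`. -/
theorem map_evalAt_universalPoint (q : MuZeroRss n S) :
    (universalPoint n).map (evalAt q).toRingHom = q := by
  refine Subtype.ext (Eq.trans ?_ (map_aeval_tautological q.1))
  refine Cotangent.ext ?_ ?_ ?_ ?_
  · ext α β
    exact evalAt_toCoordRing q _
  · ext α β
    exact evalAt_toCoordRing q _
  · ext α
    exact evalAt_toCoordRing q _
  · ext α
    exact evalAt_toCoordRing q _

theorem comp_evalAt (g : S →ₐ[ℂ] T) (q : MuZeroRss n S) :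
    g.comp (evalAt q) = evalAt (q.map g.toRingHom) := by
  refine coordRing_algHom_ext fun c => ?_
  rw [AlgHom.comp_apply, evalAt_toCoordRing, evalAt_toCoordRing, MvPolynomial.aeval_X,
    MvPolynomial.aeval_X]
  cases c <;> rfl

theorem map_evalAt (g : S →ₐ[ℂ] T) (q : MuZeroRss n S) (f : CoordRing n) :
    g (evalAt q f) = evalAt (q.map g.toRingHom) f :=
  DFunLike.congr_fun (comp_evalAt g q) f

theorem evalAt_universalPoint : evalAt (universalPoint n) = AlgHom.id ℂ (CoordRing n) := by
  refine coordRing_algHom_ext fun c => ?_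
  rw [evalAt_toCoordRing, MvPolynomial.aeval_X]
  cases c with
  | r α β h => simp [Coord.eval, universalPoint, Cotangent.map, tautological, h]
  | s α β h => simp [Coord.eval, universalPoint, Cotangent.map, tautological, h]
  | x k => rfl
  | y l => rfl

theorem evalAt_translate (b : borel n ℂ) (q : MuZeroRss n S) (f : CoordRing n) :
    evalAt q (translate b f) = evalAt (borelMap n (algebraMap ℂ S) b • q) f := by
  rw [translate, map_evalAt, MuZeroRss.map_smul, map_evalAt_universalPoint]
  congr 2
  refine congrArg (· • q) (borel_ext ?_)
  rw [coe_borelMap, coe_borelMap, coe_borelMap, Matrix.map_map]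
  congr 1
  funext z
  exact (evalAt q).commutes z

theorem mem_invariantRing {f : CoordRing n} :
    f ∈ invariantRing n ↔ ∀ b : borel n ℂ, translate b f = f := by
  simp [invariantRing, Algebra.mem_iInf, AlgHom.mem_equalizer]

/-- A `B`-invariant function takes equal values at points, with values in any algebra, that differ
by a complex point of `B`. -/
theorem evalAt_borelMap_smul {f : CoordRing n} (hf : f ∈ invariantRing n) (b : borel n ℂ)
    (q : MuZeroRss n S) : evalAt (borelMap n (algebraMap ℂ S) b • q) f = evalAt q f := by
  rw [← evalAt_translate, mem_invariantRing.mp hf b]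

theorem evalAt_smul_complex {f : CoordRing n} (hf : f ∈ invariantRing n) (b : borel n ℂ)
    (q : MuZeroRss n ℂ) : evalAt (b • q) f = evalAt q f := by
  have h : borelMap n (algebraMap ℂ ℂ) b = b := borel_ext (by rw [coe_borelMap]; ext; simp)
  simpa only [h] using evalAt_borelMap_smul hf b q

end Eval

/-! ### Invariance under unipotent matrices with entries in an algebra -/

/-- A polynomial with coefficients in a `ℂ`-algebra that vanishes at all complex points is zero. -/
theorem mvPolynomial_eq_zero_of_complex_points {A σ : Type*} [CommRing A] [Algebra ℂ A]
    (p : MvPolynomial σ A)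
    (h : ∀ c : σ → ℂ, MvPolynomial.eval (fun v => algebraMap ℂ A (c v)) p = 0) : p = 0 := by
  ext m
  rw [MvPolynomial.coeff_zero]
  -- Linear functionals separate the elements of `A`, which reduces the claim to the field `ℂ`.
  rw [← Module.forall_dual_apply_eq_zero_iff ℂ]
  intro l
  -- The polynomial obtained from `p` by applying `l` to the coefficients.
  let q : MvPolynomial σ ℂ := ∑ d ∈ p.support, MvPolynomial.monomial d (l (p.coeff d))
  have hq : q = 0 := by
    refine MvPolynomial.funext fun c => ?_
    have h1 := congrArg l (h c)
    rw [MvPolynomial.eval_eq, map_sum, map_zero] at h1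
    rw [map_zero, ← h1]
    simp only [q, map_sum, MvPolynomial.eval_monomial]
    refine Finset.sum_congr rfl fun d _ => ?_
    have e : p.coeff d * ∏ i ∈ d.support, algebraMap ℂ A (c i) ^ d i =
        (∏ i ∈ d.support, c i ^ d i) • p.coeff d := by
      rw [Algebra.smul_def, mul_comm, map_prod]
      simp
    rw [e, map_smul, smul_eq_mul, mul_comm, Finsupp.prod]
  have h2 : q.coeff m = l (p.coeff m) := by
    classical
    simp only [q, MvPolynomial.coeff_sum, MvPolynomial.coeff_monomial]
    rw [Finset.sum_ite_eq']
    split_ifs with h3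
    · rfl
    · rw [MvPolynomial.notMem_support_iff.mp h3, map_zero]
  rw [← h2, hq, MvPolynomial.coeff_zero]

/-- The upper unitriangular matrix with prescribed entries above the diagonal. -/
def unitriangular {n : ℕ} {S : Type*} [CommRing S] (c : Fin n × Fin n → S) :
    Matrix (Fin n) (Fin n) S :=
  Matrix.of fun α β => if α = β then 1 else if α < β then c (α, β) else 0

theorem unitriangular_isUpperTriangular {n : ℕ} {S : Type*} [CommRing S] (c : Fin n × Fin n → S) :
    (unitriangular c).IsUpperTriangular := by
  intro α β h
  have h' : β < α := h
  simp [unitriangular, h'.ne', h'.le]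

/-- The element of `B` given by an upper unitriangular matrix. -/
noncomputable def unipotent {n : ℕ} {S : Type*} [CommRing S] (c : Fin n × Fin n → S) : borel n S :=
  borelMk (unitriangular c) (unitriangular_isUpperTriangular c) fun α => by simp [unitriangular]

theorem borelMap_unipotent {n : ℕ} {S T : Type*} [CommRing S] [CommRing T] (f : S →+* T)
    (c : Fin n × Fin n → S) : borelMap n f (unipotent c) = unipotent fun v => f (c v) := by
  refine borel_ext ?_
  rw [coe_borelMap]
  ext α β
  simp only [unipotent, coe_borelMk, unitriangular, Matrix.map_apply, Matrix.of_apply]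
  split_ifs <;> simp

/-- Invariance under the complex points of `B` implies invariance under unitriangular matrices
with entries in any algebra, because the complex points are dense in the affine space of
unitriangular matrices. -/
theorem evalAt_unipotent_smul {n : ℕ} {S : Type*} [CommRing S] [Algebra ℂ S] {f : CoordRing n}
    (hf : f ∈ invariantRing n) (c : Fin n × Fin n → S) (q : MuZeroRss n S) :
    evalAt (unipotent c • q) f = evalAt q f := by
  -- It suffices to compare the two values at the universal point and the universal unitriangular
  -- matrix; they are polynomials over the coordinate ring in the entries of that matrix.
  let R := MvPolynomial (Fin n × Fin n) (CoordRing n)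
  let ψ : CoordRing n →ₐ[ℂ] R := IsScalarTower.toAlgHom ℂ (CoordRing n) R
  let Q : MuZeroRss n R := (universalPoint n).map ψ.toRingHom
  have hψ : ∀ g, evalAt Q g = ψ g := fun g => by
    rw [← map_evalAt, evalAt_universalPoint]; rfl
  have key : evalAt (unipotent (MvPolynomial.X : Fin n × Fin n → R) • Q) f = ψ f := by
    rw [← sub_eq_zero]
    refine mvPolynomial_eq_zero_of_complex_points _ fun z => ?_
    let g : R →ₐ[ℂ] CoordRing n := (MvPolynomial.aeval (R := CoordRing n)
      (fun v => algebraMap ℂ (CoordRing n) (z v))).restrictScalars ℂ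
    have hg : ∀ a : R, MvPolynomial.eval (fun v => algebraMap ℂ (CoordRing n) (z v)) a = g a :=
      fun a => (congrArg (fun k => k a) (MvPolynomial.coe_aeval_eq_eval _)).symm
    have hgψ : g.comp ψ = AlgHom.id ℂ _ := by
      ext a
      simp [g, ψ]
    have hQ : Q.map g.toRingHom = universalPoint n := by
      have h1 : (universalPoint n).map (evalAt Q).toRingHom = Q := map_evalAt_universalPoint Q
      have h2 := map_evalAt_universalPoint (Q.map g.toRingHom)
      rw [← h2, ← comp_evalAt]
      have h3 : g.comp (evalAt Q) = AlgHom.id ℂ _ := by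
        rw [← hgψ]
        ext a
        simp [hψ]
      rw [h3]
      rfl
    have hz : borelMap n g.toRingHom (unipotent (MvPolynomial.X : Fin n × Fin n → R)) =
        borelMap n (algebraMap ℂ (CoordRing n)) (unipotent z) := by
      rw [borelMap_unipotent, borelMap_unipotent]
      congr 1
      funext v
      exact (hg _).symm.trans (MvPolynomial.eval_X v)
    have e := map_evalAt g (unipotent (MvPolynomial.X : Fin n × Fin n → R) • Q) f
    rw [MuZeroRss.map_smul, hQ, hz, evalAt_borelMap_smul hf, evalAt_universalPoint] at e
    rw [hg, map_sub, sub_eq_zero]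
    exact e.trans (DFunLike.congr_fun hgψ f).symm
  -- Specialization to `c` and `q`.
  let h : R →ₐ[ℂ] S := MvPolynomial.aevalTower (evalAt q) c
  have hh : h.comp ψ = evalAt q := by
    ext a
    exact MvPolynomial.aevalTower_C _ _ _
  have hQ : Q.map h.toRingHom = q := by
    rw [← map_evalAt_universalPoint (Q.map h.toRingHom), ← comp_evalAt]
    have h3 : h.comp (evalAt Q) = evalAt q := by
      rw [← hh]
      ext a
      simp [hψ]
    rw [h3, map_evalAt_universalPoint]
  have e := map_evalAt h (unipotent (MvPolynomial.X : Fin n × Fin n → R) • Q) f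
  rw [MuZeroRss.map_smul, hQ, borelMap_unipotent] at e
  have hc : (fun v => h.toRingHom (MvPolynomial.X v)) = c := by
    funext v
    exact MvPolynomial.aevalTower_X _ _ _
  rw [hc] at e
  exact e.symm.trans ((congrArg h key).trans (DFunLike.congr_fun hh f))

/-! ### The functions `s'` -/

section SPrime

variable {n : ℕ} {S T : Type*} [CommRing S] [CommRing T]

open Polynomial in
theorem aeval_isUpperTriangular {r : Matrix (Fin n) (Fin n) S} (hr : r.IsUpperTriangular)
    (p : S[X]) : (aeval r p).IsUpperTriangular ∧ ∀ β, aeval r p β β = p.eval (r β β) := by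
  induction p using Polynomial.induction_on' with
  | add p q hp hq =>
    rw [map_add]
    exact ⟨hp.1.add hq.1, fun β => by simp [hp.2, hq.2]⟩
  | monomial k a =>
    have h : (r ^ k).IsUpperTriangular ∧ ∀ β, (r ^ k) β β = r β β ^ k := by
      induction k with
      | zero => exact ⟨by simpa using Matrix.blockTriangular_one, fun β => by simp⟩
      | succ k ih =>
        refine ⟨by rw [pow_succ]; exact ih.1.mul hr, fun β => ?_⟩
        rw [pow_succ, mul_diag_of_isUpperTriangular ih.1 hr, ih.2, pow_succ]
    rw [aeval_monomial, ← Algebra.smul_def]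
    refine ⟨fun α β hab => ?_, fun β => ?_⟩
    · simp [h.1 hab]
    · simp [h.2]

/-- The polynomial `∏_{k ≠ α} (X - x_k)`. -/
noncomputable def omitPoly (x : Fin n → S) (α : Fin n) : Polynomial S :=
  ∏ k ∈ Finset.univ.erase α, (Polynomial.X - Polynomial.C (x k))

theorem eval_omitPoly (x : Fin n → S) (α : Fin n) (a : S) :
    (omitPoly x α).eval a = ∏ k ∈ Finset.univ.erase α, (a - x k) := by
  simp [omitPoly, Polynomial.eval_prod]

theorem eval_omitPoly_of_ne (x : Fin n → S) {α β : Fin n} (h : β ≠ α) :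
    (omitPoly x α).eval (x β) = 0 := by
  rw [eval_omitPoly]
  exact Finset.prod_eq_zero (Finset.mem_erase.mpr ⟨h, Finset.mem_univ β⟩) (sub_self _)

theorem isUnit_eval_omitPoly {x : Fin n → S} (hx : ∀ α β, α ≠ β → IsUnit (x α - x β))
    (α : Fin n) : IsUnit ((omitPoly x α).eval (x α)) := by
  rw [eval_omitPoly, IsUnit.prod_iff]
  exact fun k hk => hx α k (Finset.ne_of_mem_erase hk).symm

theorem lProd_eq_aeval (r : Matrix (Fin n) (Fin n) S) (α : Fin n) :
    lProd r α = Polynomial.aeval r (omitPoly (fun k => r k k) α) := by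
  have h : omitPoly (fun k => r k k) α =
      (((List.finRange n).filter fun k => k ≠ α).map
        fun k => (Polynomial.X - Polynomial.C (r k k))).prod := by
    rw [← List.prod_toFinset _ ((List.nodup_finRange n).filter _), omitPoly]
    refine Finset.prod_congr ?_ fun _ _ => rfl
    ext k
    simp
  rw [h, map_list_prod, List.map_map, lProd]
  congr 2
  funext k
  simp [Polynomial.aeval_C, Matrix.algebraMap_eq_diagonal, Matrix.scalar_apply, Pi.algebraMap_def]

theorem lProd_isUpperTriangular {r : Matrix (Fin n) (Fin n) S} (hr : r.IsUpperTriangular)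
    (α : Fin n) : (lProd r α).IsUpperTriangular := by
  rw [lProd_eq_aeval]
  exact (aeval_isUpperTriangular hr _).1

theorem lProd_diag {r : Matrix (Fin n) (Fin n) S} (hr : r.IsUpperTriangular) (α β : Fin n) :
    lProd r α β β = (omitPoly (fun k => r k k) α).eval (r β β) := by
  rw [lProd_eq_aeval]
  exact (aeval_isUpperTriangular hr _).2 β

theorem trace_lProd {r : Matrix (Fin n) (Fin n) S} (hr : r.IsUpperTriangular) (α : Fin n) :
    (lProd r α).trace = (omitPoly (fun k => r k k) α).eval (r α α) := by
  rw [Matrix.trace, Finset.sum_eq_single α]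
  · exact lProd_diag hr α α
  · intro β _ h
    rw [Matrix.diag_apply, lProd_diag hr]
    exact eval_omitPoly_of_ne (fun k => r k k) h
  · simp

/-- The rows of `∏_{k ≠ α} l_k(r)` are left eigenvectors of `r` for the eigenvalue `r_{αα}`, by
the Cayley–Hamilton theorem. -/
theorem lProd_mul_self {r : Matrix (Fin n) (Fin n) S} (hr : r.IsUpperTriangular) (α : Fin n) :
    lProd r α * r = r α α • lProd r α := by
  have h : Polynomial.aeval r
      (omitPoly (fun k => r k k) α * (Polynomial.X - Polynomial.C (r α α))) = 0 := by
    rw [omitPoly, Finset.prod_erase_mul _ _ (Finset.mem_univ α),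
      ← Matrix.charpoly_of_isUpperTriangular r hr]
    exact Matrix.aeval_self_charpoly r
  rw [map_mul, ← lProd_eq_aeval, map_sub, Polynomial.aeval_X, Polynomial.aeval_C, mul_sub,
    sub_eq_zero] at h
  rw [h, ← Algebra.commutes, ← Algebra.smul_def]

theorem trace_mul_lowerPart {M : Matrix (Fin n) (Fin n) S} (hM : M.IsUpperTriangular)
    (N : Matrix (Fin n) (Fin n) S) : (M * lowerPart N).trace = (M * N).trace := by
  simp only [Matrix.trace, Matrix.diag_apply, Matrix.mul_apply]
  refine Finset.sum_congr rfl fun α _ => Finset.sum_congr rfl fun k _ => ?_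
  by_cases h : α ≤ k
  · simp [lowerPart, h]
  · have : M α k = 0 := hM (show k < α from not_le.mp h)
    simp [this]

theorem aeval_conj {b c : Matrix (Fin n) (Fin n) S} (hbc : b * c = 1) (hcb : c * b = 1)
    (r : Matrix (Fin n) (Fin n) S) (p : Polynomial S) :
    Polynomial.aeval (b * r * c) p = b * Polynomial.aeval r p * c := by
  induction p using Polynomial.induction_on' with
  | add p q hp hq => rw [map_add, map_add, hp, hq, mul_add, add_mul]
  | monomial k a =>
    have h : (b * r * c) ^ k = b * r ^ k * c := by
      induction k with
      | zero => simp [hbc]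
      | succ k ih =>
        calc (b * r * c) ^ (k + 1) = b * r ^ k * (c * b) * r * c := by
              rw [pow_succ, ih]; simp only [Matrix.mul_assoc]
          _ = b * r ^ (k + 1) * c := by
              rw [hcb, pow_succ]; simp only [Matrix.mul_assoc, Matrix.mul_one]
    rw [Polynomial.aeval_monomial, Polynomial.aeval_monomial, h, ← Algebra.smul_def,
      ← Algebra.smul_def, Matrix.mul_smul, Matrix.smul_mul]

theorem lProd_smul (b : borel n S) (q : Cotangent n S) (α : Fin n) :
    lProd (b • q).r α = b.1.1 * lProd q.r α * (b⁻¹ : borel n S).1.1 := by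
  have h : (fun k => (b • q).r k k) = fun k => q.r k k := funext fun k => smul_r_diag b q k
  rw [lProd_eq_aeval, lProd_eq_aeval, h, smul_r]
  exact aeval_conj (borel_mul_inv b) (borel_inv_mul b) q.r _

theorem sPrime_smul (b : borel n S) (q : Cotangent n S) : sPrime (b • q) = sPrime q := by
  funext α
  have h1 : (lProd (b • q).r α).trace = (lProd q.r α).trace := by
    rw [lProd_smul, Matrix.trace_mul_comm, ← Matrix.mul_assoc, borel_inv_mul, Matrix.one_mul]
  have h2 : (lProd (b • q).r α * (b • q).s).trace = (lProd q.r α * q.s).trace := by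
    rw [smul_s, trace_mul_lowerPart (lProd_isUpperTriangular (b • q).r_upper α), lProd_smul]
    have e : b.1.1 * lProd q.r α * (b⁻¹ : borel n S).1.1 *
        (b.1.1 * q.s * (b⁻¹ : borel n S).1.1) =
        b.1.1 * (lProd q.r α * ((b⁻¹ : borel n S).1.1 * b.1.1) * q.s * (b⁻¹ : borel n S).1.1) := by
      simp only [Matrix.mul_assoc]
    rw [e, Matrix.trace_mul_comm, borel_inv_mul, Matrix.mul_one, Matrix.mul_assoc, borel_inv_mul,
      Matrix.mul_one]
  rw [sPrime, sPrime, h1, h2]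

theorem lProd_map (f : S →+* T) (r : Matrix (Fin n) (Fin n) S) (α : Fin n) :
    lProd (r.map f) α = (lProd r α).map f := by
  change _ = f.mapMatrix (lProd r α)
  rw [lProd, lProd, map_list_prod, List.map_map]
  congr 2
  funext k
  ext a c
  by_cases h : a = c <;> simp [h, Matrix.scalar_apply]

theorem isUnit_trace_lProd (q : MuZeroRss n S) (α : Fin n) : IsUnit (lProd q.1.r α).trace := by
  rw [trace_lProd q.1.r_upper]
  exact isUnit_eval_omitPoly (x := fun k => q.1.r k k) q.2.2 α

theorem trace_lProd_mul_sPrime (q : MuZeroRss n S) (α : Fin n) :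
    (lProd q.1.r α).trace * sPrime q.1 α = (lProd q.1.r α * q.1.s).trace := by
  rw [sPrime, ← mul_assoc, Ring.mul_inverse_cancel _ (isUnit_trace_lProd q α), one_mul]

theorem sPrime_map (f : S →+* T) (q : MuZeroRss n S) (α : Fin n) :
    sPrime (q.map f).1 α = f (sPrime q.1 α) := by
  refine (isUnit_trace_lProd (q.map f) α).mul_left_cancel ?_
  rw [trace_lProd_mul_sPrime]
  have h : (q.map f).1.r = q.1.r.map f := rfl
  have h' : (q.map f).1.s = q.1.s.map f := rfl
  have t : ∀ M : Matrix (Fin n) (Fin n) S, (M.map f).trace = f M.trace := fun M => by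
    simp [Matrix.trace]
  rw [h, h', lProd_map, ← Matrix.map_mul, t, t, ← map_mul, trace_lProd_mul_sPrime]

end SPrime

/-! ### The slice of points with diagonal `r` -/

section Slice

variable {n : ℕ} {S T : Type*} [CommRing S] [CommRing T]

/-- The matrix `s` with diagonal `y` such that the strictly lower triangular part of
`[diag x, s] + i j` vanishes. -/
noncomputable def sliceS (x y i j : Fin n → S) : Matrix (Fin n) (Fin n) S :=
  Matrix.of fun α β =>
    if α = β then y α else if β < α then -(Ring.inverse (x α - x β) * (i α * j β)) else 0

/-- The point `(r, s, i, j)` of `μ⁻¹(0)^{rss}` for which `r` is diagonal with entries `x` and `s`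
has diagonal `y`: the off-diagonal part of `s` is determined by the moment map, and the diagonal
part of the moment map requires `i_α j_α = 0`. -/
noncomputable def slice (x y i j : Fin n → S) (hx : ∀ α β, α ≠ β → IsUnit (x α - x β))
    (hij : ∀ α, i α * j α = 0) : MuZeroRss n S :=
  ⟨{ r := Matrix.diagonal x
     s := sliceS x y i j
     i := i
     j := j
     r_upper := Matrix.blockTriangular_diagonal x
     s_lower := fun α β h => by
      have h' : α < β := h
      simp [sliceS, h'.ne, h'.le] }, by
    ext α β
    by_cases h : β ≤ α
    · simp only [moment, lowerPart, Matrix.of_apply, if_pos h, Matrix.add_apply, Matrix.sub_apply,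
        Matrix.diagonal_mul, Matrix.mul_diagonal, Matrix.vecMulVec_apply, Matrix.zero_apply]
      rcases h.eq_or_lt with rfl | h
      · rw [hij]; ring
      · simp only [sliceS, Matrix.of_apply, if_neg h.ne', if_pos h]
        linear_combination (-(i α * j β)) * Ring.mul_inverse_cancel _ (hx α β h.ne')
    · simp [moment, lowerPart, h], by
    simpa using hx⟩

theorem eq_slice_of_r_eq_diagonal (q : MuZeroRss n S) {x : Fin n → S}
    (h : q.1.r = Matrix.diagonal x) :
    ∃ (hx : ∀ α β, α ≠ β → IsUnit (x α - x β)) (hij : ∀ α, q.1.i α * q.1.j α = 0),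
      q = slice x (fun α => q.1.s α α) q.1.i q.1.j hx hij := by
  have hx : ∀ α β, α ≠ β → IsUnit (x α - x β) := by simpa [h] using q.2.2
  have hm : ∀ α β, β ≤ α → (x α - x β) * q.1.s α β + q.1.i α * q.1.j β = 0 := by
    intro α β hab
    have := congrFun (congrFun q.2.1 α) β
    simp only [moment, lowerPart, Matrix.of_apply, if_pos hab, Matrix.add_apply, Matrix.sub_apply,
      h, Matrix.diagonal_mul, Matrix.mul_diagonal, Matrix.vecMulVec_apply,
      Matrix.zero_apply] at this
    linear_combination this
  refine ⟨hx, fun α => by simpa using hm α α le_rfl, ?_⟩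
  refine Subtype.ext (Cotangent.ext h ?_ rfl rfl)
  change q.1.s = sliceS _ _ _ _
  ext α β
  rcases lt_trichotomy β α with hab | rfl | hab
  · refine (hx α β hab.ne').mul_left_cancel ?_
    simp only [sliceS, Matrix.of_apply, if_neg hab.ne', if_pos hab]
    linear_combination hm α β hab.le +
      (q.1.i α * q.1.j β) * Ring.mul_inverse_cancel _ (hx α β hab.ne')
  · simp [sliceS]
  · have : q.1.s α β = 0 := q.1.s_lower hab
    simp [sliceS, this, hab.ne, hab.le]

theorem slice_congr {x y i j x' y' i' j' : Fin n → S} {hx hij} (hx' hij') (h1 : x = x')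
    (h2 : y = y') (h3 : i = i') (h4 : j = j') :
    slice x y i j hx hij = slice x' y' i' j' hx' hij' := by
  subst h1 h2 h3 h4
  rfl

theorem map_slice (f : S →+* T) (x y i j : Fin n → S) (hx hij) :
    ∃ hx' hij', (slice x y i j hx hij).map f =
      slice (fun α => f (x α)) (fun α => f (y α)) (fun α => f (i α)) (fun α => f (j α))
        hx' hij' := by
  obtain ⟨hx', hij', e⟩ := eq_slice_of_r_eq_diagonal ((slice x y i j hx hij).map f)
    (x := fun α => f (x α)) (by
      change (Matrix.diagonal x).map f = _
      rw [Matrix.diagonal_map (map_zero f)])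
  refine ⟨hx', hij', e.trans (slice_congr _ _ rfl ?_ rfl rfl)⟩
  funext α
  change f (sliceS x y i j α α) = _
  simp [sliceS]

theorem sPrime_slice (x y i j : Fin n → S) (hx hij) : sPrime (slice x y i j hx hij).1 = y := by
  funext α
  refine (isUnit_trace_lProd (slice x y i j hx hij) α).mul_left_cancel ?_
  rw [trace_lProd_mul_sPrime, trace_lProd (slice x y i j hx hij).1.r_upper, lProd_eq_aeval]
  change (Polynomial.aeval (Matrix.diagonal x) _ * sliceS x y i j).trace = _
  have h : (fun k => (slice x y i j hx hij).1.r k k) = x := by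
    funext k
    exact Matrix.diagonal_apply_eq x k
  have h' : (slice x y i j hx hij).1.r α α = x α := congrFun h α
  rw [h', h]
  have e : Polynomial.aeval (Matrix.diagonal x) (omitPoly x α) =
      Matrix.diagonal fun β => (omitPoly x α).eval (x β) := by
    change Polynomial.aeval (Matrix.diagonalAlgHom S x) _ = _
    rw [Polynomial.aeval_algHom_apply]
    ext a c
    by_cases hac : a = c
    · subst hac
      simp [Polynomial.aeval_pi, Polynomial.aeval_def, Polynomial.eval₂_eq_eval_map]
    · simp [hac]
  rw [e, Matrix.trace, Finset.sum_eq_single α]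
  · simp [sliceS, Matrix.diagonal_mul]
  · intro β _ hβ
    rw [Matrix.diag_apply, Matrix.diagonal_mul, eval_omitPoly_of_ne x hβ, zero_mul]
  · simp

theorem eq_slice_sPrime (q : MuZeroRss n S) {x : Fin n → S} (h : q.1.r = Matrix.diagonal x) :
    ∃ (hx : ∀ α β, α ≠ β → IsUnit (x α - x β)) (hij : ∀ α, q.1.i α * q.1.j α = 0),
      q = slice x (sPrime q.1) q.1.i q.1.j hx hij := by
  obtain ⟨hx, hij, e⟩ := eq_slice_of_r_eq_diagonal q h
  have hs : sPrime q.1 = sPrime (slice x (fun α => q.1.s α α) q.1.i q.1.j hx hij).1 :=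
    congrArg (fun p : MuZeroRss n S => sPrime p.1) e
  rw [sPrime_slice] at hs
  exact ⟨hx, hij, hs ▸ e⟩

/-- Every point of `μ⁻¹(0)^{rss}` can be moved into the slice by a unitriangular matrix, whose rows
are normalized left eigenvectors of `r`. -/
theorem exists_unipotent_smul_eq_slice (q : MuZeroRss n S) :
    ∃ (c : Fin n × Fin n → S) (i j : Fin n → S)
      (hx : ∀ α β, α ≠ β → IsUnit (q.1.r α α - q.1.r β β)) (hij : ∀ α, i α * j α = 0),
      unipotent c • q = slice (fun α => q.1.r α α) (sPrime q.1) i j hx hij := by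
  have hd : ∀ α, IsUnit ((omitPoly (fun k => q.1.r k k) α).eval (q.1.r α α)) := fun α =>
    isUnit_eval_omitPoly (x := fun k => q.1.r k k) q.2.2 α
  let c : Fin n × Fin n → S := fun v =>
    Ring.inverse ((omitPoly (fun k => q.1.r k k) v.1).eval (q.1.r v.1 v.1)) *
      lProd q.1.r v.1 v.1 v.2
  have hc : ∀ α β, unitriangular c α β = c (α, β) := by
    intro α β
    rcases lt_trichotomy α β with h | rfl | h
    · simp [unitriangular, h, h.ne]
    · simp only [unitriangular, Matrix.of_apply, if_true, c]
      rw [lProd_diag q.1.r_upper, Ring.inverse_mul_cancel _ (hd α)]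
    · have : lProd q.1.r α α β = 0 := lProd_isUpperTriangular q.1.r_upper α h
      simp [unitriangular, h.ne', c, this]
  have hr : unitriangular c * q.1.r = Matrix.diagonal (fun α => q.1.r α α) * unitriangular c := by
    ext α β
    have h := congrFun (congrFun (lProd_mul_self q.1.r_upper α) α) β
    rw [Matrix.mul_apply, Matrix.smul_apply, smul_eq_mul] at h
    rw [Matrix.mul_apply, Matrix.diagonal_mul, hc]
    simp only [hc, c, mul_assoc, ← Finset.mul_sum]
    rw [h]
    ring
  have hr' : (unipotent c • q).1.r = Matrix.diagonal fun α => q.1.r α α := by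
    change unitriangular c * q.1.r * ((unipotent c)⁻¹ : borel n S).1.1 = _
    rw [hr, Matrix.mul_assoc]
    exact (congrArg _ (borel_mul_inv (unipotent c))).trans (Matrix.mul_one _)
  obtain ⟨hx, hij, e⟩ := eq_slice_sPrime _ hr'
  exact ⟨c, _, _, hx, hij, e.trans (slice_congr hx hij rfl (sPrime_smul (unipotent c) q.1) rfl rfl)⟩

/-- The element of the maximal torus with diagonal entries `t`. -/
noncomputable def torus (t : Fin n → Sˣ) : borel n S :=
  borelMk (Matrix.diagonal fun α => (t α : S)) (Matrix.blockTriangular_diagonal _) fun α => by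
    simp

theorem coe_torus_inv (t : Fin n → Sˣ) :
    ((torus t)⁻¹ : borel n S).1.1 = Matrix.diagonal fun α => ((t α)⁻¹ : Sˣ).1 := by
  have h : (torus t)⁻¹ = torus fun α => (t α)⁻¹ := by
    refine inv_eq_of_mul_eq_one_right (borel_ext ?_)
    change Matrix.diagonal _ * Matrix.diagonal _ = 1
    simp
  rw [h]
  rfl

theorem borelMap_torus (f : S →+* T) (t : Fin n → Sˣ) :
    borelMap n f (torus t) = torus fun α => Units.map f.toMonoidHom (t α) := by
  refine borel_ext ?_
  change (Matrix.diagonal _).map f = Matrix.diagonal _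
  rw [Matrix.diagonal_map (map_zero f)]
  rfl

theorem torus_smul_slice (t : Fin n → Sˣ) (x y i j : Fin n → S) (hx hij) :
    ∃ hij', torus t • slice x y i j hx hij =
      slice x y (fun α => t α * i α) (fun α => ((t α)⁻¹ : Sˣ).1 * j α) hx hij' := by
  have hr : (torus t • slice x y i j hx hij).1.r = Matrix.diagonal x := by
    change Matrix.diagonal _ * Matrix.diagonal x * ((torus t)⁻¹ : borel n S).1.1 = _
    rw [coe_torus_inv, Matrix.diagonal_mul_diagonal, Matrix.diagonal_mul_diagonal]
    congr 1
    funext α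
    rw [mul_right_comm, Units.mul_inv, one_mul]
  have hi : (torus t • slice x y i j hx hij).1.i = fun α => t α * i α := by
    change Matrix.diagonal _ *ᵥ i = _
    funext α
    rw [Matrix.mulVec_diagonal]
  have hj : (torus t • slice x y i j hx hij).1.j = fun α => ((t α)⁻¹ : Sˣ).1 * j α := by
    change j ᵥ* ((torus t)⁻¹ : borel n S).1.1 = _
    rw [coe_torus_inv]
    funext α
    rw [Matrix.vecMul_diagonal, mul_comm]
  obtain ⟨hx', hij', e⟩ := eq_slice_sPrime _ hr
  have hs : sPrime (torus t • slice x y i j hx hij).1 = y :=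
    (sPrime_smul (torus t) _).trans (sPrime_slice x y i j hx hij)
  have hij'' := hij'
  rw [hi, hj] at hij''
  exact ⟨hij'', e.trans (slice_congr hx hij'' rfl hs hi hj)⟩

end Slice

/-! ### Torus invariants of the slice -/

section TorusInvariants

variable {n : ℕ}

theorem coeff_aeval_scale {S σ : Type*} [CommRing S] (u : σ → S) (p : MvPolynomial σ S)
    (m : σ →₀ ℕ) :
    (MvPolynomial.aeval (fun v => MvPolynomial.C (u v) * MvPolynomial.X v) p).coeff m =
      p.coeff m * m.prod fun v k => u v ^ k := by
  classical
  induction p using MvPolynomial.induction_on' with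
  | add p q hp hq => rw [map_add, MvPolynomial.coeff_add, MvPolynomial.coeff_add, hp, hq, add_mul]
  | monomial d a =>
    have h : MvPolynomial.aeval (fun v => MvPolynomial.C (u v) * MvPolynomial.X v)
        (MvPolynomial.monomial d a) = MvPolynomial.monomial d (a * d.prod fun v k => u v ^ k) := by
      rw [MvPolynomial.aeval_monomial, MvPolynomial.monomial_eq (s := d), Finsupp.prod,
        Finsupp.prod, Finsupp.prod, map_mul, map_prod, MvPolynomial.algebraMap_eq, mul_assoc]
      congr 1
      rw [← Finset.prod_mul_distrib]
      refine Finset.prod_congr rfl fun v _ => ?_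
      rw [mul_pow, map_pow]
    rw [h, MvPolynomial.coeff_monomial, MvPolynomial.coeff_monomial]
    split_ifs with e
    · rw [e]
    · rw [zero_mul]

/-- The exponents of the monomials `X_α Y_α`, where `X_α` and `Y_α` are the variables with index
`Sum.inl α` and `Sum.inr α`. -/
def crossExponents (n : ℕ) : Set ((Fin n ⊕ Fin n) →₀ ℕ) :=
  Set.range fun α => Finsupp.single (Sum.inl α) 1 + Finsupp.single (Sum.inr α) 1

/-- The ideal generated by the monomials `X_α Y_α`. -/
noncomputable def crossIdeal (n : ℕ) (S : Type*) [CommRing S] :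
    Ideal (MvPolynomial (Fin n ⊕ Fin n) S) :=
  Ideal.span ((fun s => MvPolynomial.monomial s 1) '' crossExponents n)

theorem mul_mem_crossIdeal {S : Type*} [CommRing S] (α : Fin n) :
    MvPolynomial.X (Sum.inl α) * MvPolynomial.X (Sum.inr α) ∈ crossIdeal n S := by
  refine Ideal.subset_span ⟨_, ⟨α, rfl⟩, ?_⟩
  simp [MvPolynomial.X, MvPolynomial.monomial_mul]

theorem crossIdeal_le_of {S : Type*} [CommRing S] {I : Ideal (MvPolynomial (Fin n ⊕ Fin n) S)}
    (h : ∀ α, MvPolynomial.X (Sum.inl α) * MvPolynomial.X (Sum.inr α) ∈ I) :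
    crossIdeal n S ≤ I := by
  refine Ideal.span_le.mpr ?_
  rintro _ ⟨_, ⟨α, rfl⟩, rfl⟩
  have := h α
  simpa [MvPolynomial.X, MvPolynomial.monomial_mul] using this

/-- The weights by which `t ∈ (ℂ^×)^n` scales the variables `X_α` and `Y_α`. -/
noncomputable def torusWeight (S : Type*) [CommRing S] [Algebra ℂ S] (t : Fin n → ℂˣ) :
    Fin n ⊕ Fin n → S :=
  Sum.elim (fun α => algebraMap ℂ S (t α)) fun α => algebraMap ℂ S ((t α)⁻¹ : ℂˣ)

/-- Modulo the monomials `X_α Y_α`, a torus invariant polynomial is constant: a monomial other than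
`1` that is not divisible by any `X_α Y_α` has nonzero weight for some coordinate of the torus. -/
theorem sub_C_mem_crossIdeal {S : Type*} [CommRing S] [Algebra ℂ S]
    (F : MvPolynomial (Fin n ⊕ Fin n) S)
    (hF : ∀ t : Fin n → ℂˣ, MvPolynomial.aeval
      (fun v => MvPolynomial.C (torusWeight S t v) * MvPolynomial.X v) F - F ∈ crossIdeal n S) :
    F - MvPolynomial.C (F.coeff 0) ∈ crossIdeal n S := by
  classical
  refine MvPolynomial.mem_ideal_span_monomial_image.mpr fun m hm => ?_
  by_contra hcon
  rw [MvPolynomial.mem_support_iff, MvPolynomial.coeff_sub, MvPolynomial.coeff_C] at hm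
  have hm0 : m ≠ 0 := by
    rintro rfl
    simp at hm
  rw [if_neg hm0.symm, sub_zero] at hm
  have hcross : ∀ α, m (Sum.inl α) = 0 ∨ m (Sum.inr α) = 0 := by
    intro α
    by_contra hne
    push Not at hne
    refine hcon ⟨_, ⟨α, rfl⟩, fun v => ?_⟩
    rcases v with β | β <;> by_cases h : α = β
    · subst h
      simpa using Nat.one_le_iff_ne_zero.mpr hne.1
    · simp [h]
    · subst h
      simpa using Nat.one_le_iff_ne_zero.mpr hne.2
    · simp [h]
  obtain ⟨γ, hγ⟩ : ∃ γ, m (Sum.inl γ) ≠ 0 ∨ m (Sum.inr γ) ≠ 0 := by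
    by_contra hne
    push Not at hne
    refine hm0 (Finsupp.ext fun v => ?_)
    rcases v with β | β
    · exact (hne β).1
    · exact (hne β).2
  have hw : ∀ t : ℂˣ, (t : ℂ) ^ m (Sum.inl γ) * ((t⁻¹ : ℂˣ) : ℂ) ^ m (Sum.inr γ) = 1 := by
    intro t
    have h1 : (MvPolynomial.aeval (fun v => MvPolynomial.C
        (torusWeight S (Function.update 1 γ t) v) * MvPolynomial.X v) F - F).coeff m = 0 := by
      by_contra hne
      obtain ⟨e, he, hle⟩ := MvPolynomial.mem_ideal_span_monomial_image.mp
        (hF (Function.update 1 γ t)) m (MvPolynomial.mem_support_iff.mpr hne)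
      exact hcon ⟨e, he, hle⟩
    have h2 : (m.prod fun v k => torusWeight S (Function.update 1 γ t) v ^ k) =
        algebraMap ℂ S ((t : ℂ) ^ m (Sum.inl γ) * ((t⁻¹ : ℂˣ) : ℂ) ^ m (Sum.inr γ)) := by
      rw [Finsupp.prod_fintype _ _ (fun v => pow_zero _), Fintype.prod_sum_type,
        Finset.prod_eq_single γ, Finset.prod_eq_single γ]
      · simp only [torusWeight, Sum.elim_inl, Sum.elim_inr, Function.update_self, map_mul, map_pow]
      · intro β _ h
        simp [torusWeight, h]
      · simp
      · intro β _ h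
        simp [torusWeight, h]
      · simp
    rw [MvPolynomial.coeff_sub, coeff_aeval_scale, h2, mul_comm, ← Algebra.smul_def,
      sub_eq_zero] at h1
    have h3 : ((t : ℂ) ^ m (Sum.inl γ) * ((t⁻¹ : ℂˣ) : ℂ) ^ m (Sum.inr γ) - 1) • F.coeff m = 0 := by
      rw [sub_smul, h1, one_smul, sub_self]
    exact sub_eq_zero.mp ((smul_eq_zero.mp h3).resolve_right hm)
  have two_pow : ∀ k, (2 : ℂ) ^ k = 1 → k = 0 := fun k hk => by
    have : (2 : ℕ) ^ k = 1 := by exact_mod_cast hk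
    simpa using this
  rcases hcross γ with h | h
  · have := hw (Units.mk0 2 two_ne_zero)⁻¹
    rw [h] at this
    exact hγ.elim (fun h' => h' h) fun h' => h' (two_pow _ (by simpa using this))
  · have := hw (Units.mk0 2 two_ne_zero)
    rw [h] at this
    exact hγ.elim (fun h' => h' (two_pow _ (by simpa using this))) fun h' => h' h

end TorusInvariants

/-- On the slice, an invariant function does not depend on `i` and `j`. -/
theorem evalAt_slice {n : ℕ} {S : Type*} [CommRing S] [Algebra ℂ S] {f : CoordRing n}
    (hf : f ∈ invariantRing n) (x y i j : Fin n → S) (hx : ∀ α β, α ≠ β → IsUnit (x α - x β))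
    (hij : ∀ α, i α * j α = 0) :
    evalAt (slice x y i j hx hij) f = evalAt (slice x y 0 0 hx fun _ => mul_zero 0) f := by
  -- `Q` is the universal point of the slice over `(x, y)`, with coordinates `X` and `Y` for `i` and
  -- `j`, and the polynomial `F` lifts the value of `f` at `Q`.
  let R := MvPolynomial (Fin n ⊕ Fin n) S
  let A := R ⧸ crossIdeal n S
  let mk : R →ₐ[ℂ] A := Ideal.Quotient.mkₐ ℂ (crossIdeal n S)
  let X : Fin n → A := fun α => mk (MvPolynomial.X (Sum.inl α))
  let Y : Fin n → A := fun α => mk (MvPolynomial.X (Sum.inr α))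
  let ι : S →+* A := mk.toRingHom.comp MvPolynomial.C
  have hxA : ∀ α β, α ≠ β → IsUnit (ι (x α) - ι (x β)) := fun α β h => by
    rw [← map_sub]
    exact (hx α β h).map ι
  have hXY : ∀ α, X α * Y α = 0 := fun α => by
    change mk _ * mk _ = 0
    rw [← map_mul]
    exact Ideal.Quotient.eq_zero_iff_mem.mpr (mul_mem_crossIdeal α)
  let Q : MuZeroRss n A := slice (fun α => ι (x α)) (fun α => ι (y α)) X Y hxA hXY
  obtain ⟨F, hF⟩ := Ideal.Quotient.mk_surjective (evalAt Q f)
  have hFmk : mk F = evalAt Q f := hF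
  have hFK : F - MvPolynomial.C (F.coeff 0) ∈ crossIdeal n S := by
    refine sub_C_mem_crossIdeal F fun t => ?_
    -- Scaling the variables moves the universal point of the slice by an element of the torus.
    let θ : R →ₐ[ℂ] R := (MvPolynomial.aeval (R := S) fun v =>
      MvPolynomial.C (torusWeight S t v) * MvPolynomial.X v).restrictScalars ℂ
    have hθX : ∀ v, θ (MvPolynomial.X v) = MvPolynomial.C (torusWeight S t v) * MvPolynomial.X v :=
      fun v => MvPolynomial.aeval_X _ v
    have hθC : ∀ a : S, θ (MvPolynomial.C a) = MvPolynomial.C a := fun a =>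
      MvPolynomial.aeval_C _ a
    have hle : crossIdeal n S ≤ RingHom.ker (mk.comp θ) := by
      refine crossIdeal_le_of fun α => ?_
      rw [RingHom.mem_ker, AlgHom.comp_apply, map_mul, hθX, hθX, mul_mul_mul_comm, map_mul,
        map_mul mk (MvPolynomial.X _)]
      exact mul_eq_zero_of_right _ (hXY α)
    let θ' : A →ₐ[ℂ] A := Ideal.Quotient.liftₐ (crossIdeal n S) (mk.comp θ) fun a ha => hle ha
    have hθ' : ∀ a, θ' (mk a) = mk (θ a) := fun a => rfl
    obtain ⟨h1, h2, e1⟩ := map_slice θ'.toRingHom (fun α => ι (x α)) (fun α => ι (y α)) X Y hxA hXY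
    obtain ⟨h3, e2⟩ := torus_smul_slice (fun α => Units.map (algebraMap ℂ A).toMonoidHom (t α))
      (fun α => ι (x α)) (fun α => ι (y α)) X Y hxA hXY
    have hC : ∀ c : ℂ, mk (MvPolynomial.C (algebraMap ℂ S c)) = algebraMap ℂ A c := fun c =>
      mk.commutes c
    have e : Q.map θ'.toRingHom = borelMap n (algebraMap ℂ A) (torus t) • Q := by
      rw [borelMap_torus]
      refine e1.trans (Eq.trans ?_ e2.symm)
      refine slice_congr _ _ ?_ ?_ ?_ ?_
      · funext α
        exact congrArg mk (hθC (x α))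
      · funext α
        exact congrArg mk (hθC (y α))
      · funext α
        refine (congrArg mk (hθX (Sum.inl α))).trans ?_
        rw [map_mul]
        exact congrArg (· * X α) (hC _)
      · funext α
        refine (congrArg mk (hθX (Sum.inr α))).trans ?_
        rw [map_mul]
        refine congrArg (· * Y α) ((hC _).trans ?_)
        rw [← map_inv]
        rfl
    have h4 := map_evalAt θ' Q f
    rw [e, evalAt_borelMap_smul hf, ← hFmk, hθ'] at h4
    exact Ideal.Quotient.eq.mp h4
  have hmk : evalAt Q f = mk (MvPolynomial.C (F.coeff 0)) :=
    hFmk.symm.trans (Ideal.Quotient.eq.mpr hFK)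
  -- Specializing the variables to `a` and `b` turns the universal point into the given one, and
  -- keeps the constant coefficient of `F`.
  have key : ∀ (a b : Fin n → S) (hab : ∀ α, a α * b α = 0),
      evalAt (slice x y a b hx hab) f = F.coeff 0 := by
    intro a b hab
    let g : R →ₐ[ℂ] S := (MvPolynomial.aeval (R := S) (Sum.elim a b)).restrictScalars ℂ
    have hgX : ∀ v, g (MvPolynomial.X v) = Sum.elim a b v := fun v => MvPolynomial.aeval_X _ v
    have hgC : ∀ c : S, g (MvPolynomial.C c) = c := fun c => MvPolynomial.aeval_C _ c
    have hle : crossIdeal n S ≤ RingHom.ker g := by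
      refine crossIdeal_le_of fun α => ?_
      rw [RingHom.mem_ker, map_mul, hgX, hgX]
      exact hab α
    let g' : A →ₐ[ℂ] S := Ideal.Quotient.liftₐ (crossIdeal n S) g fun a ha => hle ha
    have hg' : ∀ a, g' (mk a) = g a := fun a => rfl
    obtain ⟨h1, h2, e1⟩ := map_slice g'.toRingHom (fun α => ι (x α)) (fun α => ι (y α)) X Y hxA hXY
    have e : Q.map g'.toRingHom = slice x y a b hx hab := by
      refine e1.trans (slice_congr _ _ ?_ ?_ ?_ ?_)
      · funext α
        exact hgC (x α)
      · funext α
        exact hgC (y α)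
      · funext α
        exact hgX (Sum.inl α)
      · funext α
        exact hgX (Sum.inr α)
    have h4 := map_evalAt g' Q f
    rw [e, hmk, hg', hgC] at h4
    exact h4.symm
  rw [key, key]

/-- The point `(diag x, diag y, 0, 0)` of `μ⁻¹(0)^{rss}`. -/
noncomputable def diagPoint {n : ℕ} {S : Type*} [CommRing S] (x y : Fin n → S)
    (hx : ∀ α β, α ≠ β → IsUnit (x α - x β)) : MuZeroRss n S :=
  slice x y 0 0 hx fun _ => mul_zero 0

/-- The value of an invariant function at a point depends only on the diagonal of `r` and on
`s'`. -/
theorem evalAt_eq_evalAt_diagPoint {n : ℕ} {S : Type*} [CommRing S] [Algebra ℂ S] {f : CoordRing n}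
    (hf : f ∈ invariantRing n) (q : MuZeroRss n S) :
    evalAt q f = evalAt (diagPoint (fun α => q.1.r α α) (sPrime q.1) q.2.2) f := by
  obtain ⟨c, i, j, hx, hij, e⟩ := exists_unipotent_smul_eq_slice q
  rw [← evalAt_unipotent_smul hf c q, e]
  exact evalAt_slice hf _ _ i j hx hij

/-! ### The comorphism of the quotient map -/

theorem map_diagPoint {n : ℕ} {S T : Type*} [CommRing S] [CommRing T] (g : S →+* T)
    (x y : Fin n → S) (hx) :
    ∃ hx', (diagPoint x y hx).map g = diagPoint (fun α => g (x α)) (fun α => g (y α)) hx' := by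
  obtain ⟨hx', hij', e⟩ := map_slice g x y 0 0 hx fun _ => mul_zero 0
  refine ⟨hx', e.trans (slice_congr _ _ rfl rfl ?_ ?_)⟩
  · funext α
    exact map_zero g
  · funext α
    exact map_zero g

section Comorphism

variable {n : ℕ} {S T : Type*} [CommRing S] [CommRing T] [Algebra ℂ S] [Algebra ℂ T]

/-- The coordinate ring of `ℂ^{2n} ∖ Δ_n`. -/
abbrev TargetRing (n : ℕ) : Type := Localization.Away (discPoly n)

theorem isUnit_aeval_discPoly {x y : Fin n → S} (hx : ∀ α β, α ≠ β → IsUnit (x α - x β)) :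
    IsUnit ((MvPolynomial.aeval (Sum.elim x y) : MvPolynomial (Fin n ⊕ Fin n) ℂ →ₐ[ℂ] S)
      (discPoly n)) := by
  have e := map_disc (MvPolynomial.aeval (Sum.elim x y) :
    MvPolynomial (Fin n ⊕ Fin n) ℂ →ₐ[ℂ] S).toRingHom fun α => MvPolynomial.X (Sum.inl α)
  have h : (fun α => (MvPolynomial.aeval (Sum.elim x y) :
      MvPolynomial (Fin n ⊕ Fin n) ℂ →ₐ[ℂ] S).toRingHom (MvPolynomial.X (Sum.inl α))) = x := by
    funext α
    exact MvPolynomial.aeval_X _ _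
  rw [h] at e
  exact e ▸ (isUnit_disc_iff x).mpr hx

/-- Evaluation of regular functions on `ℂ^{2n} ∖ Δ_n` at the point `(x, y)` with values in `S`. -/
noncomputable def targetEval (x y : Fin n → S) (hx : ∀ α β, α ≠ β → IsUnit (x α - x β)) :
    TargetRing n →ₐ[ℂ] S :=
  IsLocalization.Away.liftAlgHom (discPoly n) (S := TargetRing n)
    (isUnit_aeval_discPoly (y := y) hx)

theorem targetEval_algebraMap (x y : Fin n → S) (hx : ∀ α β, α ≠ β → IsUnit (x α - x β))
    (f : MvPolynomial (Fin n ⊕ Fin n) ℂ) :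
    targetEval x y hx (algebraMap _ _ f) = MvPolynomial.aeval (Sum.elim x y) f :=
  IsLocalization.Away.lift_eq _ (isUnit_aeval_discPoly (y := y) hx) f

theorem targetRing_algHom_ext {f g : TargetRing n →ₐ[ℂ] S}
    (h : ∀ v, f (algebraMap (MvPolynomial (Fin n ⊕ Fin n) ℂ) _ (MvPolynomial.X v)) =
      g (algebraMap (MvPolynomial (Fin n ⊕ Fin n) ℂ) _ (MvPolynomial.X v))) :
    f = g := by
  refine IsLocalization.algHom_ext (Submonoid.powers (discPoly n)) ?_
  exact MvPolynomial.algHom_ext h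

theorem targetEval_congr {x y x' y' : Fin n → S} {hx hx'} (h : x = x') (h' : y = y') :
    targetEval x y hx = targetEval x' y' hx' := by
  subst h h'
  rfl

theorem comp_targetEval (g : S →ₐ[ℂ] T) (x y : Fin n → S)
    (hx : ∀ α β, α ≠ β → IsUnit (x α - x β))
    (hx' : ∀ α β, α ≠ β → IsUnit (g (x α) - g (x β))) :
    g.comp (targetEval x y hx) = targetEval (fun α => g (x α)) (fun α => g (y α)) hx' := by
  refine targetRing_algHom_ext fun v => ?_
  rw [AlgHom.comp_apply, targetEval_algebraMap, targetEval_algebraMap, MvPolynomial.aeval_X,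
    MvPolynomial.aeval_X]
  cases v <;> rfl

variable (n) in
/-- The coordinates `x` of the tautological point of `ℂ^{2n} ∖ Δ_n`. -/
noncomputable def targetX : Fin n → TargetRing n := fun α =>
  algebraMap (MvPolynomial (Fin n ⊕ Fin n) ℂ) _ (MvPolynomial.X (Sum.inl α))

variable (n) in
/-- The coordinates `y` of the tautological point of `ℂ^{2n} ∖ Δ_n`. -/
noncomputable def targetY : Fin n → TargetRing n := fun α =>
  algebraMap (MvPolynomial (Fin n ⊕ Fin n) ℂ) _ (MvPolynomial.X (Sum.inr α))

theorem isUnit_targetX_sub (α β : Fin n) (h : α ≠ β) : IsUnit (targetX n α - targetX n β) := by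
  refine (isUnit_disc_iff (targetX n)).mp ?_ α β h
  have e := map_disc (algebraMap (MvPolynomial (Fin n ⊕ Fin n) ℂ) (TargetRing n))
    fun α => MvPolynomial.X (Sum.inl α)
  refine e ▸ ?_
  exact IsLocalization.Away.algebraMap_isUnit (discPoly n)

variable (n) in
/-- The comorphism of the section `(x, y) ↦ (diag x, diag y, 0, 0)` of `P`. -/
noncomputable def sectionComorphism : CoordRing n →ₐ[ℂ] TargetRing n :=
  evalAt (diagPoint (targetX n) (targetY n) isUnit_targetX_sub)

variable (n) in
/-- The comorphism of `P`, as a map to `ℂ^{2n} ∖ Δ_n`. -/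
noncomputable def localizedComorphism : TargetRing n →ₐ[ℂ] CoordRing n :=
  targetEval (fun α => (universalPoint n).1.r α α) (sPrime (universalPoint n).1)
    (universalPoint n).2.2

theorem localizedComorphism_algebraMap (f : MvPolynomial (Fin n ⊕ Fin n) ℂ) :
    localizedComorphism n (algebraMap _ _ f) = comorphismP n f :=
  targetEval_algebraMap _ _ _ f

theorem evalAt_comp_localizedComorphism (q : MuZeroRss n S) :
    (evalAt q).comp (localizedComorphism n) =
      targetEval (fun α => q.1.r α α) (sPrime q.1) q.2.2 := by
  have h := map_evalAt_universalPoint q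
  have h1 : (fun α => evalAt q ((universalPoint n).1.r α α)) = fun α => q.1.r α α :=
    congrArg (fun p : MuZeroRss n S => fun α => p.1.r α α) h
  have h2 : (fun α => evalAt q (sPrime (universalPoint n).1 α)) = sPrime q.1 := by
    funext α
    refine (sPrime_map (evalAt q).toRingHom (universalPoint n) α).symm.trans ?_
    rw [h]
  rw [localizedComorphism, comp_targetEval]
  · exact targetEval_congr h1 h2
  · intro α β hne
    rw [← map_sub]
    exact ((universalPoint n).2.2 α β hne).map (evalAt q)

theorem localizedComorphism_mem (a : TargetRing n) :
    localizedComorphism n a ∈ invariantRing n := by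
  rw [mem_invariantRing]
  intro b
  have h1 := DFunLike.congr_fun (evalAt_comp_localizedComorphism
    (borelMap n (algebraMap ℂ (CoordRing n)) b • universalPoint n)) a
  have h2 := DFunLike.congr_fun (evalAt_comp_localizedComorphism (universalPoint n)) a
  rw [evalAt_universalPoint] at h2
  refine h1.trans (Eq.trans ?_ h2.symm)
  refine DFunLike.congr_fun (targetEval_congr ?_ ?_) a
  · funext α
    exact smul_r_diag _ _ α
  · exact sPrime_smul _ _

theorem comp_sectionComorphism (g : TargetRing n →ₐ[ℂ] S) (x y : Fin n → S) (hx)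
    (h1 : ∀ α, g (targetX n α) = x α) (h2 : ∀ α, g (targetY n α) = y α) :
    g.comp (sectionComorphism n) = evalAt (diagPoint x y hx) := by
  rw [sectionComorphism, comp_evalAt]
  obtain ⟨hx', e⟩ := map_diagPoint g.toRingHom (targetX n) (targetY n) isUnit_targetX_sub
  rw [e]
  refine congrArg evalAt (slice_congr _ _ (funext h1) (funext h2) rfl rfl)

theorem targetEval_comp_sectionComorphism (x y : Fin n → S) (hx) :
    (targetEval x y hx).comp (sectionComorphism n) = evalAt (diagPoint x y hx) := by
  refine comp_sectionComorphism _ _ _ _ (fun α => ?_) fun α => ?_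
  · exact (targetEval_algebraMap _ _ _ _).trans (MvPolynomial.aeval_X _ _)
  · exact (targetEval_algebraMap _ _ _ _).trans (MvPolynomial.aeval_X _ _)

variable (n) in
/-- The comorphism of `P` is an isomorphism onto the ring of invariants; its inverse is the
restriction of invariant functions to the points `(diag x, diag y, 0, 0)`. -/
noncomputable def invariantEquiv : TargetRing n ≃ₐ[ℂ] invariantRing n :=
  AlgEquiv.ofAlgHom ((localizedComorphism n).codRestrict (invariantRing n) localizedComorphism_mem)
    ((sectionComorphism n).comp (invariantRing n).val)
    (by
      refine AlgHom.ext fun f => Subtype.ext ?_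
      change localizedComorphism n (sectionComorphism n f.1) = f.1
      have h := evalAt_eq_evalAt_diagPoint f.2 (universalPoint n)
      rw [evalAt_universalPoint, ← targetEval_comp_sectionComorphism] at h
      exact h.symm)
    (by
      refine targetRing_algHom_ext fun v => ?_
      have h := DFunLike.congr_fun (evalAt_comp_localizedComorphism
        (diagPoint (targetX n) (targetY n) isUnit_targetX_sub))
        (algebraMap (MvPolynomial (Fin n ⊕ Fin n) ℂ) _ (MvPolynomial.X v))
      refine h.trans ?_
      rw [targetEval_algebraMap, MvPolynomial.aeval_X]
      rcases v with α | α
      · exact Matrix.diagonal_apply_eq (targetX n) α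
      · exact congrFun (sPrime_slice (targetX n) (targetY n) 0 0 isUnit_targetX_sub
          fun _ => mul_zero 0) α)

theorem sectionComorphism_coe (f : invariantRing n) :
    sectionComorphism n (f : CoordRing n) = (invariantEquiv n).symm f := rfl

end Comorphism

/-! ### The bijection on complex points -/

section ComplexPoints

variable {n : ℕ}

theorem isUnit_sub_of_notMem_Delta (z : ((Delta n)ᶜ : Set (Fin n ⊕ Fin n → ℂ))) (α β : Fin n)
    (h : α ≠ β) : IsUnit (z.1 (Sum.inl α) - z.1 (Sum.inl β)) := by
  rw [isUnit_iff_ne_zero, sub_ne_zero]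
  exact fun e => z.2 ⟨α, β, h, e⟩

/-- The section `(x, y) ↦ (diag x, diag y, 0, 0)` of `P`. -/
noncomputable def sectionP (z : ((Delta n)ᶜ : Set (Fin n ⊕ Fin n → ℂ))) : MuZeroRss n ℂ :=
  diagPoint (fun α => z.1 (Sum.inl α)) (fun α => z.1 (Sum.inr α)) (isUnit_sub_of_notMem_Delta z)

theorem P_sectionP (z : ((Delta n)ᶜ : Set (Fin n ⊕ Fin n → ℂ))) : P (sectionP z) = z := by
  refine Subtype.ext (funext fun v => ?_)
  rcases v with α | α
  · exact Matrix.diagonal_apply_eq _ α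
  · exact congrFun (sPrime_slice _ _ 0 0 (isUnit_sub_of_notMem_Delta z) fun _ => mul_zero 0) α

/-- Evaluation of regular functions on `ℂ^{2n} ∖ Δ_n` at a complex point. -/
noncomputable def targetEvalAt (z : ((Delta n)ᶜ : Set (Fin n ⊕ Fin n → ℂ))) :
    TargetRing n →ₐ[ℂ] ℂ :=
  targetEval (fun α => z.1 (Sum.inl α)) (fun α => z.1 (Sum.inr α)) (isUnit_sub_of_notMem_Delta z)

theorem targetEvalAt_algebraMap (z : ((Delta n)ᶜ : Set (Fin n ⊕ Fin n → ℂ)))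
    (f : MvPolynomial (Fin n ⊕ Fin n) ℂ) :
    targetEvalAt z (algebraMap _ _ f) = MvPolynomial.aeval z.1 f := by
  rw [targetEvalAt, targetEval_algebraMap]
  congr 2
  funext v
  cases v <;> rfl

theorem targetEvalAt_comp_sectionComorphism (z : ((Delta n)ᶜ : Set (Fin n ⊕ Fin n → ℂ))) :
    (targetEvalAt z).comp (sectionComorphism n) = evalAt (sectionP z) :=
  targetEval_comp_sectionComorphism _ _ _

/-- The map `p` from the complex points of the affine quotient to `ℂ^{2n} ∖ Δ_n`. -/
noncomputable def quotientMapP (z : QuotientPoints n) :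
    ((Delta n)ᶜ : Set (Fin n ⊕ Fin n → ℂ)) :=
  ⟨fun v => z (invariantEquiv n (algebraMap (MvPolynomial (Fin n ⊕ Fin n) ℂ) _
    (MvPolynomial.X v))), by
    rintro ⟨α, β, hne, h⟩
    have hu := (isUnit_targetX_sub α β hne).map (z.comp (invariantEquiv n).toAlgHom)
    refine hu.ne_zero ?_
    rw [map_sub, sub_eq_zero]
    exact h⟩

theorem comp_invariantEquiv (z : QuotientPoints n) :
    z.comp (invariantEquiv n).toAlgHom = targetEvalAt (quotientMapP z) := by
  refine targetRing_algHom_ext fun v => ?_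
  rw [targetEvalAt_algebraMap, MvPolynomial.aeval_X]
  rfl

theorem apply_invariantEquiv_algebraMap (z : QuotientPoints n)
    (f : MvPolynomial (Fin n ⊕ Fin n) ℂ) :
    z (invariantEquiv n (algebraMap _ _ f)) = MvPolynomial.aeval (quotientMapP z).1 f :=
  (DFunLike.congr_fun (comp_invariantEquiv z) _).trans (targetEvalAt_algebraMap _ f)

theorem quotientMapP_quotientPoint (q : MuZeroRss n ℂ) : quotientMapP (quotientPoint q) = P q := by
  refine Subtype.ext (funext fun v => ?_)
  have h := DFunLike.congr_fun (evalAt_comp_localizedComorphism q)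
    (algebraMap (MvPolynomial (Fin n ⊕ Fin n) ℂ) _ (MvPolynomial.X v))
  rw [targetEval_algebraMap, MvPolynomial.aeval_X] at h
  exact h

theorem quotientPoint_sectionP_quotientMapP (z : QuotientPoints n) :
    quotientPoint (sectionP (quotientMapP z)) = z := by
  refine AlgHom.ext fun f => ?_
  change evalAt (sectionP (quotientMapP z)) f.1 = z f
  rw [← targetEvalAt_comp_sectionComorphism, ← comp_invariantEquiv]
  change z (invariantEquiv n (sectionComorphism n f.1)) = z f
  rw [sectionComorphism_coe, AlgEquiv.apply_symm_apply]

theorem quotientMapP_quotientPoint_sectionP (z : ((Delta n)ᶜ : Set (Fin n ⊕ Fin n → ℂ))) :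
    quotientMapP (quotientPoint (sectionP z)) = z := by
  rw [quotientMapP_quotientPoint, P_sectionP]

end ComplexPoints

/-! ### The Zariski topologies -/

section Zariski

variable {n : ℕ}

/-- A map on complex points that is given by a homomorphism of coordinate rings is continuous for
the Zariski topologies. -/
theorem zariski_continuous_of_comp_eq {Y Y' A A' : Type*} [CommRing A] [Algebra ℂ A] [CommRing A']
    [Algebra ℂ A'] {ev : Y → (A →ₐ[ℂ] ℂ)} {ev' : Y' → (A' →ₐ[ℂ] ℂ)} (h : Y → Y')
    (θ : A' →ₐ[ℂ] A) (hθ : ∀ y, ev' (h y) = (ev y).comp θ) :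
    @Continuous _ _ (zariski ev) (zariski ev') h := by
  let _ := zariski ev
  refine continuous_induced_rng.mpr ?_
  have e : (fun y' => (⟨RingHom.ker (ev' y'), RingHom.ker_isPrime _⟩ : PrimeSpectrum A')) ∘ h =
      PrimeSpectrum.comap θ.toRingHom ∘
        fun y => (⟨RingHom.ker (ev y), RingHom.ker_isPrime _⟩ : PrimeSpectrum A) := by
    funext y
    refine PrimeSpectrum.ext ?_
    ext a
    simp [RingHom.mem_ker, hθ]
  rw [e]
  exact (PrimeSpectrum.continuous_comap _).comp continuous_induced_dom

/-- The Zariski topology of `ℂ^{2n} ∖ Δ_n` as an affine variety is the subspace topology. -/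
theorem zariskiTarget_eq : zariskiTarget n = zariski (@targetEvalAt n) := by
  rw [zariskiTarget, zariski, zariski, (PrimeSpectrum.localization_comap_isInducing (TargetRing n)
    (Submonoid.powers (discPoly n))).eq_induced, induced_compose]
  congr 1
  funext z
  refine PrimeSpectrum.ext ?_
  ext a
  simp [RingHom.mem_ker, targetEvalAt_algebraMap]

theorem continuous_quotientPoint_zariski :
    @Continuous _ _ (zariskiRss n) (zariskiQuotient n) quotientPoint :=
  zariski_continuous_of_comp_eq _ (invariantRing n).val fun _ => rfl

theorem continuous_sectionP_zariski :
    @Continuous _ _ (zariskiTarget n) (zariskiRss n) sectionP := by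
  rw [zariskiTarget_eq]
  exact zariski_continuous_of_comp_eq _ (sectionComorphism n) fun z =>
    (targetEvalAt_comp_sectionComorphism z).symm

theorem continuous_quotientMapP_zariski :
    @Continuous _ _ (zariskiQuotient n) (zariskiTarget n) quotientMapP := by
  rw [zariskiTarget_eq]
  exact zariski_continuous_of_comp_eq _ (invariantEquiv n).toAlgHom fun z =>
    (comp_invariantEquiv z).symm

/-- Level sets of a regular function are Zariski closed, so an invariant function is constant on
orbit closures. -/
theorem evalAt_eq_of_mem_orbitClosure {f : CoordRing n} (hf : f ∈ invariantRing n)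
    {q q' : MuZeroRss n ℂ} (h : q' ∈ orbitClosure (zariskiRss n) q) :
    evalAt q' f = evalAt q f := by
  let _ := zariskiRss n
  let g : CoordRing n := f - algebraMap ℂ _ (evalAt q f)
  have hg : ∀ p : MuZeroRss n ℂ, evalAt p g = 0 ↔ evalAt p f = evalAt q f := fun p => by
    simp [g, sub_eq_zero]
  have hc : IsClosed {p : MuZeroRss n ℂ | evalAt p g = 0} := by
    have h1 : {p : MuZeroRss n ℂ | evalAt p g = 0} =
        (fun p => (⟨RingHom.ker (evalAt p), RingHom.ker_isPrime _⟩ :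
          PrimeSpectrum (CoordRing n))) ⁻¹' PrimeSpectrum.zeroLocus {g} := by
      ext p
      simp [PrimeSpectrum.mem_zeroLocus, RingHom.mem_ker]
    rw [h1]
    exact (PrimeSpectrum.isClosed_zeroLocus _).preimage continuous_induced_dom
  have hs : MulAction.orbit (borel n ℂ) q ⊆ {p : MuZeroRss n ℂ | evalAt p g = 0} := by
    rintro _ ⟨b, rfl⟩
    exact (hg _).mpr (evalAt_smul_complex hf b q)
  exact (hg q').mp (closure_minimal hs hc h)

end Zariski

/-! ### The classical topologies -/

section Classical

variable {n : ℕ}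

/-- Regular functions are continuous for the classical topology, being quotients of polynomials by
powers of the discriminant. -/
theorem continuous_evalAt (f : CoordRing n) :
    @Continuous _ _ (classicalRss n) _ fun q : MuZeroRss n ℂ => evalAt q f := by
  let _ := classicalRss n
  have hcoord : ∀ c : Coord n, Continuous fun q : MuZeroRss n ℂ => Coord.eval q.1 c := by
    have h0 : Continuous fun q : MuZeroRss n ℂ => (q.1.r, q.1.s, q.1.i, q.1.j) :=
      continuous_induced_dom
    intro c
    cases c with
    | r α β h => exact (continuous_apply_apply α β).comp h0.fst
    | s α β h => exact (continuous_apply_apply α β).comp h0.snd.fst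
    | x k => exact (continuous_apply k).comp h0.snd.snd.fst
    | y l => exact (continuous_apply l).comp h0.snd.snd.snd
  have hpoly : ∀ a : CotangentRing n,
      Continuous fun q : MuZeroRss n ℂ => evalAt q (toCoordRing n a) := by
    intro a
    simp only [evalAt_toCoordRing]
    exact (MvPolynomial.continuous_eval a).comp (continuous_pi hcoord)
  obtain ⟨f', rfl⟩ := Ideal.Quotient.mk_surjective f
  obtain ⟨⟨a, d⟩, hd⟩ := IsLocalization.surj
    (Submonoid.powers (disc fun α => (tautological n).r α α)) f'
  have hd' : ∀ q : MuZeroRss n ℂ, evalAt q (Ideal.Quotient.mk (momentIdeal n) f') *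
      evalAt q (toCoordRing n d) = evalAt q (toCoordRing n a) := fun q => by
    rw [← map_mul]
    exact congrArg (fun u => evalAt q (Ideal.Quotient.mk (momentIdeal n) u)) hd
  have hd0 : ∀ q : MuZeroRss n ℂ, evalAt q (toCoordRing n d) ≠ 0 := fun q => by
    obtain ⟨k, hk⟩ := d.2
    rw [evalAt_toCoordRing, ← hk, map_pow]
    exact pow_ne_zero _ (isUnit_aeval_disc q).ne_zero
  have e : (fun q : MuZeroRss n ℂ => evalAt q (Ideal.Quotient.mk (momentIdeal n) f')) =
      fun q => evalAt q (toCoordRing n a) / evalAt q (toCoordRing n d) :=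
    funext fun q => eq_div_of_mul_eq (hd0 q) (hd' q)
  rw [e]
  exact (hpoly a).div (hpoly d) hd0

theorem classicalRss_le_zariskiRss : classicalRss n ≤ zariskiRss n := by
  rw [← continuous_id_iff_le]
  refine continuous_induced_rng.mpr ?_
  let _ := classicalRss n
  refine PrimeSpectrum.isTopologicalBasis_basic_opens.continuous_iff.mpr ?_
  rintro _ ⟨g, rfl⟩
  have h : ((fun q : MuZeroRss n ℂ => (⟨RingHom.ker (evalAt q), RingHom.ker_isPrime _⟩ :
      PrimeSpectrum (CoordRing n))) ∘ id) ⁻¹' (PrimeSpectrum.basicOpen g : Set _) =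
      {q | evalAt q g ≠ 0} := by
    ext q
    simp [RingHom.mem_ker]
  rw [h]
  exact isOpen_ne_fun (continuous_evalAt g) continuous_const

theorem continuous_quotientPoint_classical :
    @Continuous _ _ (classicalRss n) (classicalQuotient n) quotientPoint := by
  let _ := classicalRss n
  exact continuous_induced_rng.mpr (continuous_pi fun f => continuous_evalAt f.1)

theorem continuous_quotientMapP_classical :
    @Continuous _ _ (classicalQuotient n) inferInstance (@quotientMapP n) := by
  let _ := classicalQuotient n
  have h : Continuous fun z : QuotientPoints n => (z : invariantRing n → ℂ) :=
    continuous_induced_dom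
  exact Continuous.subtype_mk (continuous_pi fun v => (continuous_apply _).comp h) _

theorem continuous_slice {Y : Type*} [TopologicalSpace Y] {x y i j : Y → Fin n → ℂ}
    (hx : ∀ u α β, α ≠ β → IsUnit (x u α - x u β)) (hij : ∀ u α, i u α * j u α = 0)
    (cx : Continuous x) (cy : Continuous y) (ci : Continuous i) (cj : Continuous j) :
    @Continuous _ _ _ (classicalRss n) fun u => slice (x u) (y u) (i u) (j u) (hx u) (hij u) := by
  refine continuous_induced_rng.mpr ?_
  refine Continuous.prodMk (Continuous.matrix_diagonal cx)
    (Continuous.prodMk (continuous_matrix fun α β => ?_) (ci.prodMk cj))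
  change Continuous fun u => sliceS (x u) (y u) (i u) (j u) α β
  simp only [sliceS, Matrix.of_apply, Ring.inverse_eq_inv']
  split_ifs with h1 h2
  · fun_prop
  · refine ((Continuous.inv₀ (by fun_prop) fun u => ?_).mul (by fun_prop)).neg
    exact (hx u α β h1).ne_zero
  · fun_prop

theorem continuous_sectionP_classical :
    @Continuous _ _ inferInstance (classicalRss n) (@sectionP n) :=
  continuous_slice (x := fun z : ((Delta n)ᶜ : Set (Fin n ⊕ Fin n → ℂ)) => fun α => z.1 (Sum.inl α))
    isUnit_sub_of_notMem_Delta (fun _ _ => mul_zero 0)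
    (continuous_pi fun _ => (continuous_apply _).comp continuous_subtype_val)
    (continuous_pi fun _ => (continuous_apply _).comp continuous_subtype_val)
    continuous_const continuous_const

/-- Every orbit contains a point of the slice, which a one-parameter subgroup of the torus
contracts to a point `(diag x, diag y, 0, 0)`: since `i_α j_α = 0`, it can scale each of the nonzero
coordinates by `t`. -/
theorem sectionP_mem_orbitClosure (q : MuZeroRss n ℂ) :
    sectionP (P q) ∈ orbitClosure (classicalRss n) q := by
  classical
  let _ := classicalRss n
  obtain ⟨c, i, j, hx, hij, e⟩ := exists_unipotent_smul_eq_slice q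
  have hij' : ∀ (t : ℂ) (α : Fin n), (t • i) α * (t • j) α = 0 := fun t α => by
    simp only [Pi.smul_apply, smul_eq_mul]
    linear_combination t * t * hij α
  let Q : ℂ → MuZeroRss n ℂ := fun t => slice _ (sPrime q.1) (t • i) (t • j) hx (hij' t)
  have hQ : Continuous Q := continuous_slice (fun _ => hx) hij' continuous_const continuous_const
    (by fun_prop) (by fun_prop)
  have hQ0 : Q 0 = sectionP (P q) :=
    slice_congr (isUnit_sub_of_notMem_Delta (P q)) (fun _ => mul_zero 0) rfl rfl
      (zero_smul ℂ i) (zero_smul ℂ j)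
  have hQt : ∀ t : ℂ, t ≠ 0 → Q t ∈ MulAction.orbit (borel n ℂ) q := by
    intro t ht
    -- If `i_α ≠ 0` then `j_α = 0`, so that the scaling by `u_α⁻¹` has no effect on `j_α`.
    let u : Fin n → ℂˣ := fun α => if i α = 0 then (Units.mk0 t ht)⁻¹ else Units.mk0 t ht
    obtain ⟨h, e'⟩ := torus_smul_slice u _ (sPrime q.1) i j hx hij
    refine ⟨torus u * unipotent c, ?_⟩
    change (torus u * unipotent c) • q = _
    rw [mul_smul, e, e']
    refine slice_congr _ _ rfl rfl ?_ ?_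
    · funext α
      by_cases h0 : i α = 0 <;> simp [u, h0]
    · funext α
      by_cases h0 : i α = 0
      · simp [u, h0]
      · have : j α = 0 := (mul_eq_zero.mp (hij α)).resolve_left h0
        simp [this]
  rw [← hQ0]
  refine mem_closure_of_tendsto (b := nhdsWithin (0 : ℂ) {0}ᶜ)
    (hQ.continuousAt.tendsto.mono_left nhdsWithin_le_nhds) ?_
  filter_upwards [self_mem_nhdsWithin] with t ht
  exact hQt t ht

end Classical

/-! ### Orbit closures and quotient topologies -/

section Quotient

variable {n : ℕ}

theorem orbitClosure_classical_subset {q : MuZeroRss n ℂ} :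
    orbitClosure (classicalRss n) q ⊆ orbitClosure (zariskiRss n) q :=
  closure.mono classicalRss_le_zariskiRss

theorem quotientPoint_eq_of_orbitClosure {q q' : MuZeroRss n ℂ}
    (h : (orbitClosure (zariskiRss n) q ∩ orbitClosure (zariskiRss n) q').Nonempty) :
    quotientPoint q = quotientPoint q' := by
  obtain ⟨p, hp, hp'⟩ := h
  exact AlgHom.ext fun f => (evalAt_eq_of_mem_orbitClosure f.2 hp).symm.trans
    (evalAt_eq_of_mem_orbitClosure f.2 hp')

theorem orbitClosure_inter_nonempty {q q' : MuZeroRss n ℂ}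
    (h : quotientPoint q = quotientPoint q') :
    (orbitClosure (classicalRss n) q ∩ orbitClosure (classicalRss n) q').Nonempty := by
  have hP : P q = P q' := by
    rw [← quotientMapP_quotientPoint, h, quotientMapP_quotientPoint]
  exact ⟨sectionP (P q), sectionP_mem_orbitClosure q, hP ▸ sectionP_mem_orbitClosure q'⟩

/-- The quotient map has the continuous section `sectionP ∘ quotientMapP`. -/
theorem isQuotientMap_quotientPoint (t₁ : TopologicalSpace (MuZeroRss n ℂ))
    (t₂ : TopologicalSpace (QuotientPoints n))
    (t₃ : TopologicalSpace ((Delta n)ᶜ : Set (Fin n ⊕ Fin n → ℂ)))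
    (h₁ : @Continuous _ _ t₁ t₂ quotientPoint) (h₂ : @Continuous _ _ t₂ t₃ quotientMapP)
    (h₃ : @Continuous _ _ t₃ t₁ sectionP) : @Topology.IsQuotientMap _ _ t₁ t₂ quotientPoint := by
  have h := @Continuous.comp _ _ _ t₂ t₃ t₁ _ _ h₃ h₂
  refine @Topology.IsQuotientMap.of_comp _ _ _ _ _ t₂ t₁ t₂ h h₁ ?_
  have e : quotientPoint ∘ sectionP ∘ quotientMapP = @id (QuotientPoints n) :=
    funext quotientPoint_sectionP_quotientMapP
  rw [e]
  exact @Topology.IsQuotientMap.id _ t₂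

theorem isHomeomorph_quotientMapP (t₂ : TopologicalSpace (QuotientPoints n))
    (t₁ : TopologicalSpace (MuZeroRss n ℂ))
    (t₃ : TopologicalSpace ((Delta n)ᶜ : Set (Fin n ⊕ Fin n → ℂ)))
    (h₁ : @Continuous _ _ t₁ t₂ quotientPoint) (h₂ : @Continuous _ _ t₂ t₃ quotientMapP)
    (h₃ : @Continuous _ _ t₃ t₁ sectionP) : @IsHomeomorph _ _ t₂ t₃ quotientMapP :=
  (@isHomeomorph_iff_exists_inverse _ _ t₂ t₃ _).mpr ⟨h₂, quotientPoint ∘ sectionP,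
    quotientPoint_sectionP_quotientMapP, quotientMapP_quotientPoint_sectionP,
    @Continuous.comp _ _ _ t₃ t₁ t₂ _ _ h₁ h₃⟩

end Quotient

/-! ### The isomorphism of schemes -/

section Scheme

open AlgebraicGeometry CategoryTheory

/-- The isomorphism of the affine quotient with the open subscheme `ℂ^{2n} ∖ Δ_n` of `ℂ^{2n}`. -/
noncomputable def affineQuotientIso (n : ℕ) : affineQuotient n ≅ (targetOpen n).toScheme :=
  Scheme.Spec.mapIso (RingEquiv.toCommRingCatIso (invariantEquiv n).toRingEquiv).op ≪≫
    (basicOpenIsoSpecAway (R := CommRingCat.of (MvPolynomial (Fin n ⊕ Fin n) ℂ)) (discPoly n)).symm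

theorem affineQuotientIso_hom_ι (n : ℕ) :
    (affineQuotientIso n).hom ≫ (targetOpen n).ι =
      Spec.map (CommRingCat.ofHom ((invariantEquiv n).toRingEquiv.toRingHom.comp
        (algebraMap (MvPolynomial (Fin n ⊕ Fin n) ℂ) (TargetRing n)))) := by
  have h : (basicOpenIsoSpecAway (R := CommRingCat.of (MvPolynomial (Fin n ⊕ Fin n) ℂ))
      (discPoly n)).inv ≫ (targetOpen n).ι =
      Spec.map (CommRingCat.ofHom
        (algebraMap (MvPolynomial (Fin n ⊕ Fin n) ℂ) (TargetRing n))) := by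
    exact (Iso.inv_comp_eq _).mpr (basicOpenIsoSpecAway_hom_SpecMap
      (R := CommRingCat.of (MvPolynomial (Fin n ⊕ Fin n) ℂ)) (discPoly n)).symm
  refine (Category.assoc _ _ _).trans ((congrArg (_ ≫ ·) h).trans ?_)
  exact (Spec.map_comp _ _).symm

end Scheme

end BorelReduction

open BorelReduction AlgebraicGeometry CategoryTheory in
theorem mainTheorem1 (n : ℕ) :
    -- the points of the affine quotient are the orbit closures, identified when they meet,
    -- and the affine quotient carries the quotient topology
    (∀ q q' : MuZeroRss n ℂ, quotientPoint q = quotientPoint q' ↔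
      (orbitClosure (zariskiRss n) q ∩ orbitClosure (zariskiRss n) q').Nonempty) ∧
    (∀ q q' : MuZeroRss n ℂ, quotientPoint q = quotientPoint q' ↔
      (orbitClosure (classicalRss n) q ∩ orbitClosure (classicalRss n) q').Nonempty) ∧
    @Topology.IsQuotientMap _ _ (zariskiRss n) (zariskiQuotient n) quotientPoint ∧
    @Topology.IsQuotientMap _ _ (classicalRss n) (classicalQuotient n) quotientPoint ∧
    -- `P` descends to a bijective homeomorphism `p`
    (∃ p : QuotientPoints n → ((Delta n)ᶜ : Set (Fin n ⊕ Fin n → ℂ)),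
      (∀ q : MuZeroRss n ℂ, p (quotientPoint q) = P q) ∧
      Function.Bijective p ∧
      @IsHomeomorph _ _ (zariskiQuotient n) (zariskiTarget n) p ∧
      @IsHomeomorph _ _ (classicalQuotient n) inferInstance p ∧
      -- `p` is an isomorphism of varieties: its comorphism is an isomorphism of coordinate rings
      ∃ φ : Localization.Away (discPoly n) ≃ₐ[ℂ] invariantRing n,
        (∀ f : MvPolynomial (Fin n ⊕ Fin n) ℂ,
          (φ (algebraMap _ _ f) : CoordRing n) = comorphismP n f) ∧
        (∀ (z : QuotientPoints n) (f : MvPolynomial (Fin n ⊕ Fin n) ℂ),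
          z (φ (algebraMap _ _ f)) = MvPolynomial.aeval (p z).1 f)) ∧
    -- the same isomorphism in terms of schemes over `ℂ`
    (∃ p : affineQuotient n ≅ (targetOpen n).toScheme,
      quotientMorphism n ≫ p.hom ≫ (targetOpen n).ι =
        Spec.map (CommRingCat.ofHom (comorphismP n).toRingHom) ∧
      p.hom ≫ (targetOpen n).ι ≫ Spec.map (CommRingCat.ofHom
          (algebraMap ℂ (MvPolynomial (Fin n ⊕ Fin n) ℂ))) =
        Spec.map (CommRingCat.ofHom (algebraMap ℂ (invariantRing n)))) := by
  refine ⟨?_, ?_, ?_, ?_, ?_, ?_⟩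
  · exact fun q q' => ⟨fun h => (orbitClosure_inter_nonempty h).mono
      (Set.inter_subset_inter orbitClosure_classical_subset orbitClosure_classical_subset),
      quotientPoint_eq_of_orbitClosure⟩
  · exact fun q q' => ⟨orbitClosure_inter_nonempty, fun h => quotientPoint_eq_of_orbitClosure
      (h.mono (Set.inter_subset_inter orbitClosure_classical_subset
        orbitClosure_classical_subset))⟩
  · exact isQuotientMap_quotientPoint _ _ (zariskiTarget n) continuous_quotientPoint_zariski
      continuous_quotientMapP_zariski continuous_sectionP_zariski
  · exact isQuotientMap_quotientPoint _ _ _ continuous_quotientPoint_classical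
      continuous_quotientMapP_classical continuous_sectionP_classical
  · refine ⟨quotientMapP, quotientMapP_quotientPoint, ?_, ?_, ?_, invariantEquiv n,
      localizedComorphism_algebraMap, apply_invariantEquiv_algebraMap⟩
    · exact Function.bijective_iff_has_inverse.mpr ⟨quotientPoint ∘ sectionP,
        quotientPoint_sectionP_quotientMapP, quotientMapP_quotientPoint_sectionP⟩
    · exact isHomeomorph_quotientMapP _ (zariskiRss n) _ continuous_quotientPoint_zariski
        continuous_quotientMapP_zariski continuous_sectionP_zariski
    · exact isHomeomorph_quotientMapP _ (classicalRss n) _ continuous_quotientPoint_classical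
        continuous_quotientMapP_classical continuous_sectionP_classical
  · refine ⟨affineQuotientIso n, ?_, ?_⟩
    · rw [affineQuotientIso_hom_ι]
      refine (Spec.map_comp _ _).symm.trans ?_
      rw [← CommRingCat.ofHom_comp]
      congr 2
      exact RingHom.ext localizedComorphism_algebraMap
    · rw [← Category.assoc, affineQuotientIso_hom_ι]
      refine (Spec.map_comp _ _).symm.trans ?_
      rw [← CommRingCat.ofHom_comp]
      congr 2
      exact ((invariantEquiv n).toAlgHom.comp (IsScalarTower.toAlgHom ℂ
        (MvPolynomial (Fin n ⊕ Fin n) ℂ) (TargetRing n))).comp_algebraMap
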